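/- Let $(B,g_B)$ and $(F,g_F)$ be smooth Riemannian manifolds (without boundary) of dimensions $n_1\ge 2$ and $n_2\ge 2$, with $B$ connected, let $f:B\to(0,\infty)$ be smooth, and let $M=B\times_f F$ be the warped product, i.e. $B\times F$ with the metric $g=g_B\oplus f^2g_F$ and Levi-Civita connection $\nabla$. Let $P$ be a smooth vector field on $M$, put $\pi(Y)=g(Y,P)$, and let $\overline\nabla_XY=\nabla_XY+\pi(Y)X$ be the associated semi-symmetric non-metric connection; thus $\overline\nabla g\neq 0$ (equivalently, $P$ is not identically zero). Let $\overline R(X,Y)=\overline\nabla_X\overline\nabla_Y-\overline\nabla_Y\overline\nabla_X-\overline\nabla_{[X,Y]}$ be its curvature and $\overline{Ric}(X,Y)=\sum_k g(\overline R(X,E_k)Y,E_k)$, with $(E_k)$ a $g$-orthonormal frame, its Ricci tensor. Suppose that $M$ is generalized quasi-Einstein with respect to $\overline\nabla$: $\overline{Ric}\neq 0$, and there are real numbers $a,b,c$ and smooth vector fields $U_1,U_2$ on $M$ with $g(U_1,U_1)=g(U_2,U_2)=1$ and $g(U_1,U_2)=0$ such that $$\overline{Ric}(X,Y)=a\,g(X,Y)+b\,g(X,U_1)g(Y,U_1)+c\,g(X,U_2)g(Y,U_2)$$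 for all vector fields $X,Y$ on $M$. Suppose that $P,U_1,U_2$ are tangent to $F$, i.e. tangent at every point to the fibers $\{p\}\times F$ (they may depend on $p\in B$). If $b\neq 0$ or $c\neq 0$, and if $P$ is parallel on $F$ with respect to the Levi-Civita connection of $(F,g_F)$, i.e. for each $p\in B$ the vector field $P(p,\cdot)$ on $F$ is parallel, then $f$ is constant (so $M$ is simply a Riemannian product). -/

import Mathlib

open Bundle Module
open scoped Manifold ContDiff Bundle

noncomputable section

namespace WarpedProduct

section Geometry

variable {E : Type*} [NormedAddCommGroup E] [NormedSpace ℝ E]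
  {H : Type*} [TopologicalSpace H] {I : ModelWithCorners ℝ E H}
  {M : Type*} [TopologicalSpace M] [ChartedSpace H M]

/-- `X` is a smooth vector field on `M`. -/
def IsSmoothField (I : ModelWithCorners ℝ E H) [IsManifold I ∞ M]
    (X : ∀ x : M, TangentSpace I x) : Prop :=
  ContMDiff I I.tangent ∞ (fun x => (⟨x, X x⟩ : TangentBundle I M))

/-- A linear connection `D` on `TM` is metric, `D g = 0`: for differentiable vector fields `Y, Z`,
`v (g(Y, Z)) = g(D_v Y, Z) + g(Y, D_v Z)`. (`D Y x v` is `D_v Y` at `x`.) -/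
def IsMetric [IsManifold I ∞ M]
    (g : RiemannianMetric (fun x : M => TangentSpace I x))
    (D : CovariantDerivative I E (TangentSpace I : M → Type _)) : Prop :=
  ∀ (Y Z : ∀ x : M, TangentSpace I x) (x : M),
    MDifferentiableAt I I.tangent (fun y => (⟨y, Y y⟩ : TangentBundle I M)) x →
    MDifferentiableAt I I.tangent (fun y => (⟨y, Z y⟩ : TangentBundle I M)) x →
    ∀ v : TangentSpace I x,
      mvfderiv I (fun y => g.inner y (Y y) (Z y)) x v
        = g.inner x (D Y x v) (Z x) + g.inner x (Y x) (D Z x v)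

/-- `D` is the Levi-Civita connection of `g`: the smooth linear connection on `TM` that is
torsion-free, `D_X Y - D_Y X = [X, Y]`, and metric. -/
structure IsLeviCivita [FiniteDimensional ℝ E] [IsManifold I ∞ M]
    (g : RiemannianMetric (fun x : M => TangentSpace I x))
    (D : CovariantDerivative I E (TangentSpace I : M → Type _)) : Prop where
  smooth : D.ContMDiffCovariantDerivative ∞
  torsion_eq_zero : D.torsion = 0
  metric : IsMetric g D

/-- The semi-symmetric connection `∇̄_X Y = ∇_X Y + π(Y) X` with `π(Y) = g(Y, P)`, made from a
linear connection `∇` and a vector field `P`. -/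
def semiSymmetric [IsManifold I ∞ M]
    (g : RiemannianMetric (fun x : M => TangentSpace I x))
    (D : CovariantDerivative I E (TangentSpace I : M → Type _))
    (P : ∀ x : M, TangentSpace I x) :
    CovariantDerivative I E (TangentSpace I : M → Type _) :=
  D.addOneForm fun x =>
    (g.inner x (P x)).smulRight (ContinuousLinearMap.id ℝ (TangentSpace I x))

/-- `R(X, Y) Z = D_X (D_Y Z) - D_Y (D_X Z) - D_[X, Y] Z` for vector fields. -/
def curvature [IsManifold I ∞ M]
    (D : CovariantDerivative I E (TangentSpace I : M → Type _))
    (X Y Z : ∀ x : M, TangentSpace I x) (x : M) : TangentSpace I x :=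
  D (fun y => D Z y (Y y)) x (X x) - D (fun y => D Z y (X y)) x (Y x)
    - D Z x (VectorField.mlieBracket I X Y x)

/-- The curvature tensor at a point, `R(u, v) w` for tangent vectors `u, v, w` at `x`. The vectors
are extended to vector fields that are smooth near `x`; for a smooth connection the value does not
depend on the extensions. -/
def curvatureAt [IsManifold I ∞ M]
    (D : CovariantDerivative I E (TangentSpace I : M → Type _))
    (x : M) (u v w : TangentSpace I x) : TangentSpace I x :=
  curvature D (FiberBundle.extend E u) (FiberBundle.extend E v) (FiberBundle.extend E w) x

/-- The Ricci tensor of the connection `D` on the Riemannian manifold `(M, g)`, with the sign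
convention `Ric(u, w) = ∑ₖ g(R(u, eₖ) w, eₖ)`, where `e` is an orthonormal basis of the tangent
space at `x`. -/
def ricci [FiniteDimensional ℝ E] [IsManifold I ∞ M]
    (g : RiemannianMetric (fun x : M => TangentSpace I x))
    (D : CovariantDerivative I E (TangentSpace I : M → Type _))
    (x : M) (u w : TangentSpace I x) : ℝ :=
  letI : RiemannianBundle (fun x : M => TangentSpace I x) := ⟨g⟩
  haveI : FiniteDimensional ℝ (TangentSpace I x) := inferInstanceAs (FiniteDimensional ℝ E)
  let e := stdOrthonormalBasis ℝ (TangentSpace I x)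
  ∑ k, g.inner x (curvatureAt D x u (e k) w) (e k)

/-- `(M, g)` with the linear connection `D` is generalized quasi-Einstein with scalars `a, b, c` and
generators `U₁, U₂`. -/
structure IsGeneralizedQuasiEinstein [FiniteDimensional ℝ E] [IsManifold I ∞ M]
    (g : RiemannianMetric (fun x : M => TangentSpace I x))
    (D : CovariantDerivative I E (TangentSpace I : M → Type _))
    (a b c : ℝ) (U₁ U₂ : ∀ x : M, TangentSpace I x) : Prop where
  smooth₁ : IsSmoothField I U₁
  smooth₂ : IsSmoothField I U₂
  unit₁ : ∀ x, g.inner x (U₁ x) (U₁ x) = 1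
  unit₂ : ∀ x, g.inner x (U₂ x) (U₂ x) = 1
  orthogonal : ∀ x, g.inner x (U₁ x) (U₂ x) = 0
  ricci_ne_zero : ∃ (x : M) (u v : TangentSpace I x), ricci g D x u v ≠ 0
  ricci_eq : ∀ (x : M) (u v : TangentSpace I x),
    ricci g D x u v = a * g.inner x u v
      + b * (g.inner x u (U₁ x) * g.inner x v (U₁ x))
      + c * (g.inner x u (U₂ x) * g.inner x v (U₂ x))

end Geometry

section Warped

variable {E₁ : Type*} [NormedAddCommGroup E₁] [NormedSpace ℝ E₁]
  {E₂ : Type*} [NormedAddCommGroup E₂] [NormedSpace ℝ E₂]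
  {B : Type*} [TopologicalSpace B] [ChartedSpace E₁ B]
  {F : Type*} [TopologicalSpace F] [ChartedSpace E₂ F]

/-- The differential at `x` of the projection `B × F → B`. -/
def baseProj (x : B × F) :
    TangentSpace (𝓘(ℝ, E₁).prod 𝓘(ℝ, E₂)) x →L[ℝ] TangentSpace 𝓘(ℝ, E₁) x.1 :=
  ContinuousLinearMap.fst ℝ E₁ E₂

/-- The differential at `x` of the projection `B × F → F`. -/
def fiberProj (x : B × F) :
    TangentSpace (𝓘(ℝ, E₁).prod 𝓘(ℝ, E₂)) x →L[ℝ] TangentSpace 𝓘(ℝ, E₂) x.2 :=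
  ContinuousLinearMap.snd ℝ E₁ E₂

open scoped Pointwise in
/-- The warped product metric `g_B ⊕ f² g_F` on `B × F`. -/
def warpedMetric
    (gB : RiemannianMetric (fun p : B => TangentSpace 𝓘(ℝ, E₁) p))
    (gF : RiemannianMetric (fun q : F => TangentSpace 𝓘(ℝ, E₂) q))
    (f : B → ℝ) (hf : ∀ p, 0 < f p) :
    RiemannianMetric (fun x : B × F => TangentSpace (𝓘(ℝ, E₁).prod 𝓘(ℝ, E₂)) x) where
  inner x :=
    (ContinuousLinearMap.bilinearComp (E := E₁) (F := E₁) (gB.inner x.1)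
          (ContinuousLinearMap.fst ℝ E₁ E₂) (ContinuousLinearMap.fst ℝ E₁ E₂)
        + f x.1 ^ 2 • ContinuousLinearMap.bilinearComp (E := E₂) (F := E₂) (gF.inner x.2)
          (ContinuousLinearMap.snd ℝ E₁ E₂) (ContinuousLinearMap.snd ℝ E₁ E₂) :
      E₁ × E₂ →L[ℝ] E₁ × E₂ →L[ℝ] ℝ)
  symm x v w :=
    congrArg₂ (fun s t : ℝ => s + f x.1 ^ 2 * t)
      (gB.symm x.1 (baseProj x v) (baseProj x w)) (gF.symm x.2 (fiberProj x v) (fiberProj x w))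
  pos x v hv := by
    change 0 < gB.inner x.1 (baseProj x v) (baseProj x v)
      + f x.1 ^ 2 * gF.inner x.2 (fiberProj x v) (fiberProj x v)
    have hB : 0 ≤ gB.inner x.1 (baseProj x v) (baseProj x v) := by
      by_cases h : baseProj x v = 0
      · simp [h]
      · exact (gB.pos _ _ h).le
    have hF : 0 ≤ gF.inner x.2 (fiberProj x v) (fiberProj x v) := by
      by_cases h : fiberProj x v = 0
      · simp [h]
      · exact (gF.pos _ _ h).le
    have hf2 : 0 < f x.1 ^ 2 := pow_pos (hf x.1) 2
    by_cases h : baseProj x v = 0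
    · have h' : fiberProj x v ≠ 0 := fun h' => hv (Prod.ext h h')
      have := mul_pos hf2 (gF.pos _ _ h')
      linarith
    · have := gB.pos _ _ h
      have := mul_nonneg hf2.le hF
      linarith
  continuousAt x := by
    have hB : Continuous (fun v : E₁ × E₂ =>
        ContinuousLinearMap.bilinearComp (E := E₁) (F := E₁) (gB.inner x.1)
          (ContinuousLinearMap.fst ℝ E₁ E₂) (ContinuousLinearMap.fst ℝ E₁ E₂) v v) := by
      fun_prop
    have hF : Continuous (fun v : E₁ × E₂ =>
        ContinuousLinearMap.bilinearComp (E := E₂) (F := E₂) (gF.inner x.2)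
          (ContinuousLinearMap.snd ℝ E₁ E₂) (ContinuousLinearMap.snd ℝ E₁ E₂) v v) := by
      fun_prop
    exact (hB.add (hF.const_smul (f x.1 ^ 2))).continuousAt
  isVonNBounded x := by
    have hf1 : 0 < f x.1 := hf x.1
    have key : Bornology.IsVonNBounded ℝ
        ((show Set E₁ from {v | gB.inner x.1 v v < 1}) ×ˢ
          ((f x.1)⁻¹ • (show Set E₂ from {v | gF.inner x.2 v v < 1}))) := by
      rw [NormedSpace.isVonNBounded_iff]
      have h1 : Bornology.IsBounded (show Set E₁ from {v | gB.inner x.1 v v < 1}) :=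
        (NormedSpace.isVonNBounded_iff ℝ).1 (gB.isVonNBounded x.1)
      have h2 : Bornology.IsBounded (show Set E₂ from {v | gF.inner x.2 v v < 1}) :=
        (NormedSpace.isVonNBounded_iff ℝ).1 (gF.isVonNBounded x.2)
      exact h1.prod (h2.smul₀ _)
    refine key.subset ?_
    intro v hv
    have hv' : gB.inner x.1 (baseProj x v) (baseProj x v)
        + f x.1 ^ 2 * gF.inner x.2 (fiberProj x v) (fiberProj x v) < 1 := hv
    have hB : 0 ≤ gB.inner x.1 (baseProj x v) (baseProj x v) := by
      by_cases h : baseProj x v = 0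
      · simp [h]
      · exact (gB.pos _ _ h).le
    have hF : 0 ≤ gF.inner x.2 (fiberProj x v) (fiberProj x v) := by
      by_cases h : fiberProj x v = 0
      · simp [h]
      · exact (gF.pos _ _ h).le
    have := mul_nonneg (pow_pos hf1 2).le hF
    refine ⟨?_, (Set.mem_inv_smul_set_iff₀ hf1.ne' _ _).2 ?_⟩
    · change gB.inner x.1 (baseProj x v) (baseProj x v) < 1
      linarith
    · change gF.inner x.2 (f x.1 • fiberProj x v) (f x.1 • fiberProj x v) < 1
      have e : gF.inner x.2 (f x.1 • fiberProj x v) (f x.1 • fiberProj x v)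
          = f x.1 ^ 2 * gF.inner x.2 (fiberProj x v) (fiberProj x v) := by
        simp [pow_two, mul_assoc]
      rw [e]
      linarith

theorem warpedMetric_inner
    (gB : RiemannianMetric (fun p : B => TangentSpace 𝓘(ℝ, E₁) p))
    (gF : RiemannianMetric (fun q : F => TangentSpace 𝓘(ℝ, E₂) q))
    (f : B → ℝ) (hf : ∀ p, 0 < f p) (x : B × F)
    (v w : TangentSpace (𝓘(ℝ, E₁).prod 𝓘(ℝ, E₂)) x) :
    (warpedMetric gB gF f hf).inner x v w
      = gB.inner x.1 (baseProj x v) (baseProj x w)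
        + f x.1 ^ 2 * gF.inner x.2 (fiberProj x v) (fiberProj x w) := rfl

/-- The vector field `X` on `B × F` is tangent to the fibers `{p} × F`. -/
def IsTangentToFiber
    (X : ∀ x : B × F, TangentSpace (𝓘(ℝ, E₁).prod 𝓘(ℝ, E₂)) x) : Prop :=
  ∀ x, baseProj x (X x) = 0

end Warped

end WarpedProduct

end

/-! The whole argument lives in the mixed (horizontal, vertical) part of the Ricci tensor. Write `n`
for the dimension of the product, `X` for a horizontal and `V` for a vertical vector. Tracing the
curvature of the semi-symmetric connection gives `Ric̄(Y, Z) = Ric(Y, Z) + (n - 1) (g(∇_Y P, Z) -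
π(Y) π(Z))` (`ricci_semiSymmetric`). A warped product has no mixed `Ric`, and `π(X) = 0` because `P`
is vertical. The right side of the quasi-Einstein equation has no mixed part either, since `U₁` and
`U₂` are vertical. Hence `g(∇_X P, V) = 0` and `g(∇_V P, X) = 0`
(`inner_covariantDerivative_eq_zero_of_mixed_ricci_eq_zero`).

Taking `V = P` in the first identity, `|P|²` is constant along each slice `B × {q}`
(`inner_self_const_along_base`). As the connection is not metric, `P` is nonzero somewhere, hence on
a whole slice. Taking `V = P` in the second and differentiating `g(X, P) = 0` along `P` gives `0 =
g(∇_P X, P) = (X f / f) |P|²`, so `df = 0` at every point of the base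
(`mvfderiv_eq_zero_of_inner_covariantDerivative_eq_zero`). Connectedness of `B` finishes the proof.

The vanishing of the mixed Ricci tensor is computed with coordinate fields of product charts. They
commute, so the Koszul formula has no bracket terms and yields `∇_X V = ∇_V X = (X f / f) V`. It
follows that the curvature endomorphisms whose traces are the mixed Ricci terms have zero diagonal
blocks. -/

noncomputable section

namespace WarpedProduct

open FiberBundle VectorField Filter
open scoped Topology

/-! ### Coordinate vector fields of a chart -/

section CoordinateFields

variable {E : Type*} [NormedAddCommGroup E] [NormedSpace ℝ E]
  {H : Type*} [TopologicalSpace H] {I : ModelWithCorners ℝ E H}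
  {M : Type*} [TopologicalSpace M] [ChartedSpace H M] [IsManifold I ∞ M]

/-- The local extension of a tangent vector at `x` with constant coefficients in the preferred
chart at `x`. -/
def coordField {x : M} (u : TangentSpace I x) : ∀ y : M, TangentSpace I y :=
  FiberBundle.extend (E := (TangentSpace I : M → Type _)) E u

@[simp]
theorem coordField_self {x : M} (u : TangentSpace I x) : coordField u x = u :=
  FiberBundle.extend_apply_self E u

/-- The preferred trivialization at `x` is the identity on the fiber over `x` itself, so the
constant coefficient of the extension is `u`, with no change of coordinates. -/
theorem coordField_eq_symmL {x y : M} (hy : y ∈ (chartAt H x).source) (u : TangentSpace I x) :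
    coordField u y = (trivializationAt E (TangentSpace I) x).symmL ℝ y (show E from u) := by
  have h1 : (trivializationAt E (TangentSpace I) x ⟨x, u⟩).2 = (show E from u) := by
    have := congrArg (fun L => L u) (mfderiv_extChartAt_self (I := I) (x := x))
    rw [← TangentBundle.continuousLinearMapAt_trivializationAt (mem_chart_source H x)] at this
    rw [← Trivialization.continuousLinearMapAt_apply_of_mem (R := ℝ)]
    · exact this
    · exact mem_chart_source H x
  rw [Trivialization.symmL_apply _ hy]
  exact congrArg (fun w : E => (trivializationAt E (TangentSpace I) x).symm y w) h1

/-- The constant vector field on a vector space. -/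
def constField (w : E) (z : E) : TangentSpace 𝓘(ℝ, E) z := w

theorem mlieBracket_constField (v w : E) (z : E) :
    mlieBracket 𝓘(ℝ, E) (constField v) (constField w) z = 0 := by
  rw [← mlieBracketWithin_univ, mlieBracketWithin_eq_lieBracketWithin]
  change fderivWithin ℝ (fun _ => w) Set.univ z v - fderivWithin ℝ (fun _ => v) Set.univ z w = 0
  simp

theorem mfderiv_extChartAt_coordField {x y : M} (hy : y ∈ (chartAt H x).source)
    (u : TangentSpace I x) :
    mfderiv I 𝓘(ℝ, E) (extChartAt I x) y (coordField u y) =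
      constField (show E from u) (extChartAt I x y) := by
  rw [coordField_eq_symmL hy, ← TangentBundle.continuousLinearMapAt_trivializationAt hy]
  exact Trivialization.continuousLinearMapAt_symmL (R := ℝ)
    (trivializationAt E (TangentSpace I) x) (b := y) hy u

theorem coordField_add {x y : M} (hy : y ∈ (chartAt H x).source) (u v : TangentSpace I x) :
    coordField (u + v) y = coordField u y + coordField v y := by
  simp only [coordField_eq_symmL hy]
  exact map_add _ _ _

theorem coordField_smul {x y : M} (hy : y ∈ (chartAt H x).source) (c : ℝ)
    (u : TangentSpace I x) : coordField (c • u) y = c • coordField u y := by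
  simp only [coordField_eq_symmL hy]
  exact map_smul _ _ _

theorem coordField_zero {x y : M} (hy : y ∈ (chartAt H x).source) :
    coordField (0 : TangentSpace I x) y = 0 := by
  have := coordField_smul hy (0 : ℝ) (0 : TangentSpace I x)
  rwa [zero_smul, zero_smul] at this

theorem exists_coordField_eq {x y : M} (hy : y ∈ (chartAt H x).source) (z : TangentSpace I y) :
    ∃ u : TangentSpace I x, coordField u y = z := by
  refine ⟨(trivializationAt E (TangentSpace I) x).continuousLinearMapAt ℝ y z, ?_⟩
  exact (coordField_eq_symmL hy _).trans (Trivialization.symmL_continuousLinearMapAt (R := ℝ)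
    (trivializationAt E (TangentSpace I) x) (b := y) hy z)

theorem contMDiffAt_coordField {x y : M} (hy : y ∈ (chartAt H x).source) (u : TangentSpace I x) :
    ContMDiffAt I I.tangent ∞ (fun y => (⟨y, coordField u y⟩ : TangentBundle I M)) y := by
  let t := trivializationAt E (TangentSpace I : M → Type _) x
  refine (t.contMDiffAt_section_iff (IB := I) (n := ∞) (s := coordField u) (x₀ := y) hy).2 ?_
  refine (contMDiffAt_const (c := (t ⟨x, u⟩).2)).congr_of_eventuallyEq ?_
  filter_upwards [(chartAt H x).open_source.mem_nhds hy] with z hz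
  change (t ⟨z, t.symm z (t ⟨x, u⟩).2⟩).2 = _
  rw [t.apply_mk_symm hz]

theorem mdifferentiableAt_coordField {x y : M} (hy : y ∈ (chartAt H x).source)
    (u : TangentSpace I x) :
    MDifferentiableAt I I.tangent (fun y => (⟨y, coordField u y⟩ : TangentBundle I M)) y :=
  (contMDiffAt_coordField hy u).mdifferentiableAt (by simp)

/-- Coordinate fields are pullbacks of constant fields under the chart, and the Lie bracket is
natural under pullback. -/
theorem mlieBracket_coordField [CompleteSpace E] {x y : M} (hy : y ∈ (chartAt H x).source)
    (u v : TangentSpace I x) : mlieBracket I (coordField u) (coordField v) y = 0 := by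
  have key : ∀ w : TangentSpace I x, coordField w =ᶠ[𝓝 y]
      mpullback I 𝓘(ℝ, E) (extChartAt I x) (constField (show E from w)) := by
    intro w
    filter_upwards [(chartAt H x).open_source.mem_nhds hy] with z hz
    have hz' : z ∈ (extChartAt I x).source := by rwa [extChartAt_source]
    rw [mpullback_apply]
    exact ((isInvertible_mfderiv_extChartAt hz').inverse_apply_eq.2
      (mfderiv_extChartAt_coordField hz w).symm).symm
  rw [(key u).mlieBracket_vectorField_eq (key v)]
  have : IsManifold I (minSmoothness ℝ 2) M := by
    rw [minSmoothness_of_isRCLikeNormedField]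
    infer_instance
  have hc : ∀ w : E, MDifferentiableAt 𝓘(ℝ, E) 𝓘(ℝ, E).tangent
      (fun z : E => (⟨z, constField w z⟩ : TangentBundle 𝓘(ℝ, E) E)) (extChartAt I x y) := by
    intro w
    exact (contMDiffAt_vectorSpace_iff_contDiffAt.2
      (contDiffAt_const (n := 1))).mdifferentiableAt one_ne_zero
  rw [← mpullback_mlieBracket (n := minSmoothness ℝ 2) (hc u) (hc v)
    (contMDiffAt_extChartAt' hy) le_rfl, mpullback_apply]
  exact (congrArg _ (mlieBracket_constField (show E from u) (show E from v) _)).trans (map_zero _)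

end CoordinateFields

/-! ### Locality and smoothness of connections; curvature in coordinate fields -/

section Connection

variable {E : Type*} [NormedAddCommGroup E] [NormedSpace ℝ E]
  {H : Type*} [TopologicalSpace H] {I : ModelWithCorners ℝ E H}
  {M : Type*} [TopologicalSpace M] [ChartedSpace H M] [IsManifold I ∞ M]
  {D : CovariantDerivative I E (TangentSpace I : M → Type _)}

theorem covariantDerivative_congr {Y Z : ∀ x : M, TangentSpace I x} {x : M}
    (hY : MDifferentiableAt I I.tangent (fun y => (⟨y, Y y⟩ : TangentBundle I M)) x)
    (h : Y =ᶠ[𝓝 x] Z) : D Y x = D Z x := by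
  refine D.isCovariantDerivativeOnUniv.congr_of_eventuallyEq hY (hY.congr_of_eventuallyEq ?_)
    univ_mem h
  filter_upwards [h] with y hy
  rw [hy]

theorem covariantDerivative_add {Y Z : ∀ x : M, TangentSpace I x} {x : M}
    (hY : MDifferentiableAt I I.tangent (fun y => (⟨y, Y y⟩ : TangentBundle I M)) x)
    (hZ : MDifferentiableAt I I.tangent (fun y => (⟨y, Z y⟩ : TangentBundle I M)) x) :
    D (fun y => Y y + Z y) x = D Y x + D Z x :=
  D.isCovariantDerivativeOnUniv.add hY hZ

theorem covariantDerivative_smul {Z : ∀ x : M, TangentSpace I x} {h : M → ℝ} {x : M}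
    (hZ : MDifferentiableAt I I.tangent (fun y => (⟨y, Z y⟩ : TangentBundle I M)) x)
    (hh : MDifferentiableAt I 𝓘(ℝ, ℝ) h x) (v : TangentSpace I x) :
    D (fun y => h y • Z y) x v = h x • D Z x v + mvfderiv I h x v • Z x := by
  have := congrArg (fun L => L v) (D.isCovariantDerivativeOnUniv.leibniz hZ hh)
  exact this

theorem mdifferentiableAt_field_smul {Z : ∀ x : M, TangentSpace I x} {h : M → ℝ} {x : M}
    (hZ : MDifferentiableAt I I.tangent (fun y => (⟨y, Z y⟩ : TangentBundle I M)) x)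
    (hh : MDifferentiableAt I 𝓘(ℝ, ℝ) h x) :
    MDifferentiableAt I I.tangent (fun y => (⟨y, h y • Z y⟩ : TangentBundle I M)) x :=
  hh.smul_section hZ

/-- Smoothness of a connection is applied to global sections, while `Z` is only smooth near `x`.
Multiplying `Z` by a bump function supported in the good neighbourhood makes it global, and locality
of `D` shows that nothing changes near `x`. -/
theorem contMDiffAt_covariantDerivative [FiniteDimensional ℝ E] [T2Space M]
    (hD : D.ContMDiffCovariantDerivative ∞) {X Z : ∀ x : M, TangentSpace I x} {x : M}
    (hZ : ∀ᶠ z in 𝓝 x, ContMDiffAt I I.tangent ∞ (fun y => (⟨y, Z y⟩ : TangentBundle I M)) z)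
    (hX : ContMDiffAt I I.tangent ∞ (fun y => (⟨y, X y⟩ : TangentBundle I M)) x) :
    ContMDiffAt I I.tangent ∞ (fun y => (⟨y, D Z y (X y)⟩ : TangentBundle I M)) x := by
  obtain ⟨U, hU, hUo, hxU⟩ := eventually_nhds_iff.1 hZ
  obtain ⟨ψ, -, hψ⟩ := (SmoothBumpFunction.nhds_basis_tsupport (I := I) x).mem_iff.1
    (hUo.mem_nhds hxU)
  have hglob : ContMDiff I I.tangent ∞
      (fun y => (⟨y, ψ y • Z y⟩ : TangentBundle I M)) :=
    ContMDiffOn.smul_section_of_tsupport (ψ := ψ) (s := Z) ψ.contMDiff.contMDiffOn hUo hψ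
      (fun y hy => (hU y hy).contMDiffWithinAt)
  have hDs := hD.contMDiff.contMDiff (σ := fun y => ψ y • Z y)
    (by simpa using hglob.contMDiffOn)
  have hDx := (hDs x (Set.mem_univ x)).contMDiffAt univ_mem
  refine (hDx.clm_bundle_apply hX).congr_of_eventuallyEq ?_
  filter_upwards [hUo.mem_nhds hxU, eventually_eventually_nhds.2 ψ.eventuallyEq_one] with y hy h1
  have : D Z y = D (fun y => ψ y • Z y) y := by
    refine covariantDerivative_congr ((hU y hy).mdifferentiableAt (by simp)) ?_
    filter_upwards [h1] with z hz
    rw [hz]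
    exact (one_smul ℝ (Z z)).symm
  rw [this]

theorem mdifferentiableAt_covariantDerivative_coordField [FiniteDimensional ℝ E] [T2Space M]
    (hD : D.ContMDiffCovariantDerivative ∞) {x y : M} (hy : y ∈ (chartAt H x).source)
    (u v : TangentSpace I x) :
    MDifferentiableAt I I.tangent
      (fun y => (⟨y, D (coordField u) y (coordField v y)⟩ : TangentBundle I M)) y := by
  refine (contMDiffAt_covariantDerivative hD ?_ (contMDiffAt_coordField hy v)).mdifferentiableAt
    (by simp)
  filter_upwards [(chartAt H x).open_source.mem_nhds hy] with z hz
  exact contMDiffAt_coordField hz u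

theorem covariantDerivative_coordField_comm [FiniteDimensional ℝ E] (hD : D.torsion = 0) {x y : M}
    (hy : y ∈ (chartAt H x).source) (u v : TangentSpace I x) :
    D (coordField u) y (coordField v y) = D (coordField v) y (coordField u y) := by
  have : CompleteSpace E := FiniteDimensional.complete ℝ E
  have h := (CovariantDerivative.torsion_eq_zero_iff D).1 hD
    (mdifferentiableAt_coordField hy v) (mdifferentiableAt_coordField hy u)
  rw [mlieBracket_coordField hy] at h
  exact sub_eq_zero.1 h

theorem curvatureAt_eq [CompleteSpace E] (x : M) (u v w : TangentSpace I x) :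
    curvatureAt D x u v w = D (fun y => D (coordField w) y (coordField v y)) x u
      - D (fun y => D (coordField w) y (coordField u y)) x v := by
  change D (fun y => D (coordField w) y (coordField v y)) x (coordField u x)
      - D (fun y => D (coordField w) y (coordField u y)) x (coordField v x)
      - D (coordField w) x (mlieBracket I (coordField u) (coordField v) x) = _
  rw [mlieBracket_coordField (mem_chart_source H x), map_zero, sub_zero, coordField_self,
    coordField_self]

end Connection

/-! ### Ricci as a trace, the semi-symmetric correction, and the Koszul formula -/

section Ricci

variable {E : Type*} [NormedAddCommGroup E] [NormedSpace ℝ E] [FiniteDimensional ℝ E]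
  {H : Type*} [TopologicalSpace H] {I : ModelWithCorners ℝ E H}
  {M : Type*} [TopologicalSpace M] [ChartedSpace H M] [IsManifold I ∞ M]
  {D : CovariantDerivative I E (TangentSpace I : M → Type _)}

/-- The curvature endomorphism `v ↦ R(u, v) w` of a smooth connection. -/
def curvatureEnd [T2Space M] (hD : D.ContMDiffCovariantDerivative ∞) {x : M}
    (u w : TangentSpace I x) : TangentSpace I x →ₗ[ℝ] TangentSpace I x where
  toFun v := curvatureAt D x u v w
  map_add' v v' := by
    have : CompleteSpace E := FiniteDimensional.complete ℝ E
    have hx := mem_chart_source H x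
    have h : D (fun y => D (coordField w) y (coordField (v + v') y)) x =
        D (fun y => D (coordField w) y (coordField v y)) x +
          D (fun y => D (coordField w) y (coordField v' y)) x := by
      rw [← covariantDerivative_add
        (mdifferentiableAt_covariantDerivative_coordField hD hx w v)
        (mdifferentiableAt_covariantDerivative_coordField hD hx w v')]
      refine covariantDerivative_congr
        (mdifferentiableAt_covariantDerivative_coordField hD hx w _) ?_
      filter_upwards [(chartAt H x).open_source.mem_nhds hx] with y hy
      rw [coordField_add hy, map_add]
    simp only [curvatureAt_eq, h, map_add]
    change D _ x u + D _ x u - _ = _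
    abel
  map_smul' c v := by
    have : CompleteSpace E := FiniteDimensional.complete ℝ E
    have hx := mem_chart_source H x
    have h : D (fun y => D (coordField w) y (coordField (c • v) y)) x u =
        c • D (fun y => D (coordField w) y (coordField v y)) x u := by
      have h1 := covariantDerivative_smul (D := D) (h := fun _ => c)
        (mdifferentiableAt_covariantDerivative_coordField hD hx w v)
        mdifferentiableAt_const u
      -- The coefficient is constant, so the Leibniz rule leaves no derivative term.
      rw [mvfderiv_const] at h1
      have h2 : D (fun y => D (coordField w) y (coordField (c • v) y)) x =
          D (fun y => c • D (coordField w) y (coordField v y)) x := by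
        refine covariantDerivative_congr
          (mdifferentiableAt_covariantDerivative_coordField hD hx w _) ?_
        filter_upwards [(chartAt H x).open_source.mem_nhds hx] with y hy
        rw [coordField_smul hy, map_smul]
      rw [h2, h1]
      change _ + (0 : ℝ) • _ = _
      rw [zero_smul, add_zero]
    simp only [curvatureAt_eq, h, map_smul, RingHom.id_apply]
    rw [smul_sub]

/-- Removes the orthonormal basis from the Ricci tensor, so that rank-one terms and block
decompositions can be handled by trace identities. -/
theorem ricci_eq_trace (g : RiemannianMetric (fun x : M => TangentSpace I x)) {x : M}
    {u w : TangentSpace I x} (A : TangentSpace I x →ₗ[ℝ] TangentSpace I x)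
    (hA : ∀ v, curvatureAt D x u v w = A v) :
    ricci g D x u w = LinearMap.trace ℝ (TangentSpace I x) A := by
  let : RiemannianBundle (fun x : M => TangentSpace I x) := ⟨g⟩
  have : FiniteDimensional ℝ (TangentSpace I x) := inferInstanceAs (FiniteDimensional ℝ E)
  rw [LinearMap.trace_eq_sum_inner A (stdOrthonormalBasis ℝ (TangentSpace I x))]
  refine Finset.sum_congr rfl fun k _ => ?_
  rw [hA]
  exact g.symm x _ _

/-- The metric `g` pairs differentiable vector fields to differentiable functions. -/
def IsDifferentiableMetric (g : RiemannianMetric (fun x : M => TangentSpace I x)) : Prop :=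
  ∀ (Y Z : ∀ x : M, TangentSpace I x) (x : M),
    MDifferentiableAt I I.tangent (fun y => (⟨y, Y y⟩ : TangentBundle I M)) x →
    MDifferentiableAt I I.tangent (fun y => (⟨y, Z y⟩ : TangentBundle I M)) x →
    MDifferentiableAt I 𝓘(ℝ, ℝ) (fun y => g.inner y (Y y) (Z y)) x

omit [FiniteDimensional ℝ E] in
theorem semiSymmetric_apply (g : RiemannianMetric (fun x : M => TangentSpace I x))
    (P Z : ∀ x : M, TangentSpace I x) (x : M) (v : TangentSpace I x) :
    semiSymmetric g D P Z x v = D Z x v + g.inner x (P x) (Z x) • v := rfl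

omit [FiniteDimensional ℝ E] in
theorem semiSymmetric_zero (g : RiemannianMetric (fun x : M => TangentSpace I x)) :
    semiSymmetric g D (fun _ => 0) = D := by
  refine CovariantDerivative.ext ?_
  funext Z x
  refine ContinuousLinearMap.ext fun v => ?_
  change D Z x v + g.inner x 0 (Z x) • v = D Z x v
  simp

/-- Metricity expands the derivative of `π(w)` as `g(∇P, w) + π(∇w)`. After antisymmetrizing, the
`π(∇w)` terms cancel in pairs and the `∇_u v - ∇_v u` term vanishes because coordinate fields
commute and `D` has no torsion. -/
theorem curvatureAt_semiSymmetric [T2Space M]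
    {g : RiemannianMetric (fun x : M => TangentSpace I x)} (hg : IsDifferentiableMetric g)
    (hD : IsLeviCivita g D) {P : ∀ x : M, TangentSpace I x} (hP : IsSmoothField I P)
    (x : M) (u v w : TangentSpace I x) :
    curvatureAt (semiSymmetric g D P) x u v w = curvatureAt D x u v w
      + g.inner x (D P x u) w • v - g.inner x (D P x v) w • u
      + g.inner x (P x) w • (g.inner x (P x) v • u - g.inner x (P x) u • v) := by
  have : CompleteSpace E := FiniteDimensional.complete ℝ E
  have hx := mem_chart_source H x
  have hPx := (hP x).mdifferentiableAt (by simp)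
  have hw := mdifferentiableAt_coordField hx w
  have hπ := hg P (coordField w) x hPx hw
  -- The second covariant derivative of `w` along `a`, then `b`, before antisymmetrizing.
  have key : ∀ a b : TangentSpace I x,
      semiSymmetric g D P (fun y => semiSymmetric g D P (coordField w) y (coordField a y)) x b =
        D (fun y => D (coordField w) y (coordField a y)) x b
        + g.inner x (P x) w • D (coordField a) x b
        + (g.inner x (D P x b) w + g.inner x (P x) (D (coordField w) x b)) • a
        + (g.inner x (P x) (D (coordField w) x a)
            + g.inner x (P x) w * g.inner x (P x) a) • b := by
    intro a b
    have h1 := mdifferentiableAt_covariantDerivative_coordField hD.smooth hx w a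
    have ha := mdifferentiableAt_coordField hx a
    have e : (fun y => semiSymmetric g D P (coordField w) y (coordField a y)) =
        fun y => D (coordField w) y (coordField a y)
          + g.inner y (P y) (coordField w y) • coordField a y := rfl
    rw [e, semiSymmetric_apply, covariantDerivative_add h1 (mdifferentiableAt_field_smul ha hπ)]
    change D _ x b + D _ x b + _ = _
    rw [covariantDerivative_smul ha hπ, hD.metric P (coordField w) x hPx hw b]
    simp only [coordField_self, map_add, map_smul, smul_eq_mul]
    module
  rw [curvatureAt_eq, curvatureAt_eq, key, key]
  have hs := covariantDerivative_coordField_comm hD.torsion_eq_zero hx v u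
  simp only [coordField_self] at hs
  rw [hs]
  module

/-- In the trace over `v`, each multiple of the identity contributes `n` times its coefficient and
the matching rank-one map removes one copy; this is the origin of the factor `n - 1`. -/
theorem ricci_semiSymmetric [T2Space M]
    {g : RiemannianMetric (fun x : M => TangentSpace I x)} (hg : IsDifferentiableMetric g)
    (hD : IsLeviCivita g D) {P : ∀ x : M, TangentSpace I x} (hP : IsSmoothField I P)
    (x : M) (u w : TangentSpace I x) :
    ricci g (semiSymmetric g D P) x u w =
      LinearMap.trace ℝ (TangentSpace I x) (curvatureEnd hD.smooth u w)
      + (finrank ℝ E - 1) * (g.inner x (D P x u) w - g.inner x (P x) u * g.inner x (P x) w) := by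
  let α : TangentSpace I x →ₗ[ℝ] ℝ := (g.inner x (P x)).toLinearMap
  let ρ : TangentSpace I x →ₗ[ℝ] ℝ := (g.inner x w).toLinearMap ∘ₗ (D P x).toLinearMap
  have : FiniteDimensional ℝ (TangentSpace I x) := inferInstanceAs (FiniteDimensional ℝ E)
  rw [ricci_eq_trace g (curvatureEnd hD.smooth u w + ρ u • LinearMap.id - ρ.smulRight u
    + α w • (α.smulRight u - α u • LinearMap.id))]
  · simp only [map_add, map_sub, map_smul, LinearMap.trace_id, LinearMap.trace_smulRight]
    have e1 : ρ u = g.inner x (D P x u) w := g.symm x _ _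
    have e2 : ∀ v, α v = g.inner x (P x) v := fun _ => rfl
    have e3 : finrank ℝ (TangentSpace I x) = finrank ℝ E := rfl
    simp only [e1, e2, e3, smul_eq_mul]
    ring
  · intro v
    rw [curvatureAt_semiSymmetric hg hD hP, g.symm x _ w, g.symm x _ w]
    rfl

/-- The Koszul formula, free of bracket terms because coordinate fields commute. -/
theorem two_mul_inner_covariantDerivative_coordField
    {g : RiemannianMetric (fun x : M => TangentSpace I x)} (hD : IsLeviCivita g D)
    {x y : M} (hy : y ∈ (chartAt H x).source) (u v w : TangentSpace I x) :
    2 * g.inner y (D (coordField v) y (coordField u y)) (coordField w y) =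
      mvfderiv I (fun z => g.inner z (coordField v z) (coordField w z)) y (coordField u y)
      + mvfderiv I (fun z => g.inner z (coordField u z) (coordField w z)) y (coordField v y)
      - mvfderiv I (fun z => g.inner z (coordField u z) (coordField v z)) y (coordField w y) := by
  have hc := fun u : TangentSpace I x => mdifferentiableAt_coordField hy u
  rw [hD.metric _ _ y (hc v) (hc w), hD.metric _ _ y (hc u) (hc w), hD.metric _ _ y (hc u) (hc v),
    covariantDerivative_coordField_comm hD.torsion_eq_zero hy u v,
    covariantDerivative_coordField_comm hD.torsion_eq_zero hy u w,
    covariantDerivative_coordField_comm hD.torsion_eq_zero hy v w,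
    g.symm y (coordField v y)]
  ring

end Ricci

/-! ### Derivatives and coordinate fields on a product -/

section Product

variable {E₁ : Type*} [NormedAddCommGroup E₁] [NormedSpace ℝ E₁]
  {E₂ : Type*} [NormedAddCommGroup E₂] [NormedSpace ℝ E₂]
  {B : Type*} [TopologicalSpace B] [ChartedSpace E₁ B]
  {F : Type*} [TopologicalSpace F] [ChartedSpace E₂ F]

omit [NormedSpace ℝ E₁] [NormedSpace ℝ E₂] in
theorem mem_chartAt_source_prod {x y : B × F} :
    y ∈ (chartAt (ModelProd E₁ E₂) x).source ↔
      y.1 ∈ (chartAt E₁ x.1).source ∧ y.2 ∈ (chartAt E₂ x.2).source := Iff.rfl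

theorem exists_eq_horizontal_add_vertical {x : B × F}
    (w : TangentSpace (𝓘(ℝ, E₁).prod 𝓘(ℝ, E₂)) x) :
    ∃ a v : TangentSpace (𝓘(ℝ, E₁).prod 𝓘(ℝ, E₂)) x,
      w = a + v ∧ fiberProj x a = 0 ∧ baseProj x v = 0 := by
  refine ⟨((show E₁ × E₂ from w).1, (0 : E₂)), ((0 : E₁), (show E₁ × E₂ from w).2), ?_, rfl, rfl⟩
  exact (Prod.fst_add_snd (show E₁ × E₂ from w)).symm

theorem mfderiv_fst_eq_baseProj (x : B × F) :
    mfderiv (𝓘(ℝ, E₁).prod 𝓘(ℝ, E₂)) 𝓘(ℝ, E₁) (Prod.fst : B × F → B) x = baseProj x :=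
  mfderiv_fst

theorem mfderiv_snd_eq_fiberProj (x : B × F) :
    mfderiv (𝓘(ℝ, E₁).prod 𝓘(ℝ, E₂)) 𝓘(ℝ, E₂) (Prod.snd : B × F → F) x = fiberProj x :=
  mfderiv_snd

theorem mvfderiv_comp_fst {k : B → ℝ} {y : B × F} (hk : MDifferentiableAt 𝓘(ℝ, E₁) 𝓘(ℝ, ℝ) k y.1)
    (v : TangentSpace (𝓘(ℝ, E₁).prod 𝓘(ℝ, E₂)) y) :
    mvfderiv (𝓘(ℝ, E₁).prod 𝓘(ℝ, E₂)) (fun z : B × F => k z.1) y v =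
      mvfderiv 𝓘(ℝ, E₁) k y.1 (baseProj y v) := by
  rw [← mfderiv_fst_eq_baseProj]
  exact mvfderiv_comp_apply y hk mdifferentiableAt_fst v

theorem mvfderiv_comp_snd {k : F → ℝ} {y : B × F} (hk : MDifferentiableAt 𝓘(ℝ, E₂) 𝓘(ℝ, ℝ) k y.2)
    (v : TangentSpace (𝓘(ℝ, E₁).prod 𝓘(ℝ, E₂)) y) :
    mvfderiv (𝓘(ℝ, E₁).prod 𝓘(ℝ, E₂)) (fun z : B × F => k z.2) y v =
      mvfderiv 𝓘(ℝ, E₂) k y.2 (fiberProj y v) := by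
  rw [← mfderiv_snd_eq_fiberProj]
  exact mvfderiv_comp_apply y hk mdifferentiableAt_snd v

theorem _root_.Filter.EventuallyEq.mvfderiv_apply_eq {E : Type*} [NormedAddCommGroup E]
    [NormedSpace ℝ E] {H : Type*} [TopologicalSpace H] {I : ModelWithCorners ℝ E H}
    {M : Type*} [TopologicalSpace M] [ChartedSpace H M] {h k : M → ℝ} {y : M}
    (hk : h =ᶠ[𝓝 y] k) (v : TangentSpace I y) : mvfderiv I h y v = mvfderiv I k y v := by
  have := hk.mfderiv_eq (I := I) (I' := 𝓘(ℝ, ℝ))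
  exact congrArg (fun L : E →L[ℝ] ℝ => L v) this

/-- No regularity of `k` is needed: near `y` it can be replaced by the restriction of `h` to the
slice through `y`, which is differentiable whenever `h` is. -/
theorem mvfderiv_eq_zero_of_base {h : B × F → ℝ} {k : B → ℝ} {y : B × F}
    (hk : ∀ᶠ z in 𝓝 y, h z = k z.1) {v : TangentSpace (𝓘(ℝ, E₁).prod 𝓘(ℝ, E₂)) y}
    (hv : baseProj y v = 0) : mvfderiv (𝓘(ℝ, E₁).prod 𝓘(ℝ, E₂)) h y v = 0 := by
  by_cases hd : MDifferentiableAt (𝓘(ℝ, E₁).prod 𝓘(ℝ, E₂)) 𝓘(ℝ, ℝ) h y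
  · have hι : MDifferentiableAt 𝓘(ℝ, E₁) (𝓘(ℝ, E₁).prod 𝓘(ℝ, E₂))
        (fun p : B => (p, y.2)) y.1 := mdifferentiableAt_id.prodMk mdifferentiableAt_const
    have hc : MDifferentiableAt 𝓘(ℝ, E₁) 𝓘(ℝ, ℝ) (fun p : B => h (p, y.2)) y.1 :=
      MDifferentiableAt.comp (g := h) y.1 hd hι
    have hlim : Tendsto (fun z : B × F => (z.1, y.2)) (𝓝 y) (𝓝 y) := by
      have : Continuous (fun z : B × F => (z.1, y.2)) := by fun_prop
      simpa using this.tendsto y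
    have : h =ᶠ[𝓝 y] fun z => h (z.1, y.2) := by
      filter_upwards [hk, hlim.eventually hk] with z h1 h2
      rw [h1, h2]
    rw [this.mvfderiv_apply_eq, mvfderiv_comp_fst hc, hv, map_zero]
  -- Where `h` is not differentiable, its derivative is zero by convention.
  · rw [mvfderiv, mfderiv_zero_of_not_mdifferentiableAt hd]
    simp

theorem mvfderiv_fst_sq_mul_snd {f : B → ℝ} {k : F → ℝ} {y : B × F}
    (hf : MDifferentiableAt 𝓘(ℝ, E₁) 𝓘(ℝ, ℝ) f y.1)
    (hk : MDifferentiableAt 𝓘(ℝ, E₂) 𝓘(ℝ, ℝ) k y.2)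
    (v : TangentSpace (𝓘(ℝ, E₁).prod 𝓘(ℝ, E₂)) y) :
    mvfderiv (𝓘(ℝ, E₁).prod 𝓘(ℝ, E₂)) (fun z : B × F => f z.1 ^ 2 * k z.2) y v =
      2 * f y.1 * mvfderiv 𝓘(ℝ, E₁) f y.1 (baseProj y v) * k y.2
        + f y.1 ^ 2 * mvfderiv 𝓘(ℝ, E₂) k y.2 (fiberProj y v) := by
  have hf' : MDifferentiableAt (𝓘(ℝ, E₁).prod 𝓘(ℝ, E₂)) 𝓘(ℝ, ℝ) (fun z : B × F => f z.1) y :=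
    MDifferentiableAt.comp (g := f) y hf mdifferentiableAt_fst
  have hk' : MDifferentiableAt (𝓘(ℝ, E₁).prod 𝓘(ℝ, E₂)) 𝓘(ℝ, ℝ) (fun z : B × F => k z.2) y :=
    MDifferentiableAt.comp (g := k) y hk mdifferentiableAt_snd
  have hff : MDifferentiableAt (𝓘(ℝ, E₁).prod 𝓘(ℝ, E₂)) 𝓘(ℝ, ℝ)
    (fun z : B × F => f z.1 * f z.1) y := hf'.mul hf'
  simp only [pow_two]
  have e1 := congrArg (fun L => L v) (mvfderiv_mul hff hk')
  have e2 := congrArg (fun L => L v) (mvfderiv_mul hf' hf')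
  have e3 := mvfderiv_comp_fst hf v
  have e4 := mvfderiv_comp_snd hk v
  refine e1.trans ?_
  change (f y.1 * f y.1) * mvfderiv _ _ y v + k y.2 * mvfderiv _ _ y v = _
  erw [e2]
  change _ * _ + k y.2 * (f y.1 * mvfderiv _ _ y v + f y.1 * mvfderiv _ _ y v) = _
  rw [e3, e4]
  ring

/-- The factor `k` is recovered near `y.2` as `h (y.1, ·) / f(y.1)²`, so it inherits
differentiability from `h`; a horizontal derivative then only sees `f²`. -/
theorem mvfderiv_of_fst_sq_mul_snd {f : B → ℝ} {h : B × F → ℝ} {k : F → ℝ} {y : B × F}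
    (hf : MDifferentiableAt 𝓘(ℝ, E₁) 𝓘(ℝ, ℝ) f y.1) (hfy : f y.1 ≠ 0)
    (hd : MDifferentiableAt (𝓘(ℝ, E₁).prod 𝓘(ℝ, E₂)) 𝓘(ℝ, ℝ) h y)
    (hk : ∀ᶠ z in 𝓝 y, h z = f z.1 ^ 2 * k z.2) {v : TangentSpace (𝓘(ℝ, E₁).prod 𝓘(ℝ, E₂)) y}
    (hv : fiberProj y v = 0) :
    mvfderiv (𝓘(ℝ, E₁).prod 𝓘(ℝ, E₂)) h y v =
      2 * (mvfderiv 𝓘(ℝ, E₁) f y.1 (baseProj y v) / f y.1) * h y := by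
  have hι : MDifferentiableAt 𝓘(ℝ, E₂) (𝓘(ℝ, E₁).prod 𝓘(ℝ, E₂))
      (fun q : F => (y.1, q)) y.2 := mdifferentiableAt_const.prodMk mdifferentiableAt_id
  have hc : MDifferentiableAt 𝓘(ℝ, E₂) 𝓘(ℝ, ℝ) (fun q : F => h (y.1, q)) y.2 :=
    MDifferentiableAt.comp (g := h) y.2 hd hι
  have hc' : MDifferentiableAt 𝓘(ℝ, E₂) 𝓘(ℝ, ℝ)
      (fun q : F => (f y.1 ^ 2)⁻¹ * h (y.1, q)) y.2 := mdifferentiableAt_const.mul hc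
  have hlim : Tendsto (fun z : B × F => (y.1, z.2)) (𝓝 y) (𝓝 y) := by
    have : Continuous (fun z : B × F => (y.1, z.2)) := by fun_prop
    simpa using this.tendsto y
  have : h =ᶠ[𝓝 y] fun z => f z.1 ^ 2 * ((f y.1 ^ 2)⁻¹ * h (y.1, z.2)) := by
    filter_upwards [hk, hlim.eventually hk] with z h1 h2
    rw [h1, h2]
    field_simp
  rw [this.mvfderiv_apply_eq, mvfderiv_fst_sq_mul_snd hf hc', hv, map_zero]
  field_simp
  simp

variable [IsManifold 𝓘(ℝ, E₁) ∞ B] [IsManifold 𝓘(ℝ, E₂) ∞ F]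

/-- The chart of the product is the product of the charts. Both sides have the same constant image
under the invertible differential of the base chart. -/
theorem baseProj_coordField {x y : B × F} (hy : y ∈ (chartAt (ModelProd E₁ E₂) x).source)
    (u : TangentSpace (𝓘(ℝ, E₁).prod 𝓘(ℝ, E₂)) x) :
    baseProj y (coordField u y) = coordField (baseProj x u) y.1 := by
  have hy1 : y.1 ∈ (extChartAt 𝓘(ℝ, E₁) x.1).source := by
    rw [extChartAt_source]; exact (mem_chartAt_source_prod.1 hy).1
  have hinj := (isInvertible_mfderiv_extChartAt hy1).injective
  apply hinj
  rw [mfderiv_extChartAt_coordField (mem_chartAt_source_prod.1 hy).1]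
  have h1 : mfderiv (𝓘(ℝ, E₁).prod 𝓘(ℝ, E₂)) 𝓘(ℝ, E₁)
      (extChartAt 𝓘(ℝ, E₁) x.1 ∘ Prod.fst) y = _ :=
    mfderiv_comp y (mdifferentiableAt_extChartAt (mem_chartAt_source_prod.1 hy).1)
      mdifferentiableAt_fst
  have h2 : mfderiv (𝓘(ℝ, E₁).prod 𝓘(ℝ, E₂)) 𝓘(ℝ, E₁)
      (ContinuousLinearMap.fst ℝ E₁ E₂ ∘ extChartAt (𝓘(ℝ, E₁).prod 𝓘(ℝ, E₂)) x) y = _ :=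
    mfderiv_comp y (ContinuousLinearMap.fst ℝ E₁ E₂).mdifferentiableAt
      (mdifferentiableAt_extChartAt hy)
  rw [ContinuousLinearMap.mfderiv_eq] at h2
  rw [mfderiv_fst_eq_baseProj] at h1
  have h3 := congrArg (fun L : E₁ × E₂ →L[ℝ] E₁ => L (coordField u y)) (h1.symm.trans h2)
  refine h3.trans ?_
  exact congrArg (fun w : E₁ × E₂ => w.1) (mfderiv_extChartAt_coordField hy u)

theorem fiberProj_coordField {x y : B × F} (hy : y ∈ (chartAt (ModelProd E₁ E₂) x).source)
    (u : TangentSpace (𝓘(ℝ, E₁).prod 𝓘(ℝ, E₂)) x) :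
    fiberProj y (coordField u y) = coordField (fiberProj x u) y.2 := by
  have hy2 : y.2 ∈ (extChartAt 𝓘(ℝ, E₂) x.2).source := by
    rw [extChartAt_source]; exact (mem_chartAt_source_prod.1 hy).2
  have hinj := (isInvertible_mfderiv_extChartAt hy2).injective
  apply hinj
  rw [mfderiv_extChartAt_coordField (mem_chartAt_source_prod.1 hy).2]
  have h1 : mfderiv (𝓘(ℝ, E₁).prod 𝓘(ℝ, E₂)) 𝓘(ℝ, E₂)
      (extChartAt 𝓘(ℝ, E₂) x.2 ∘ Prod.snd) y = _ :=
    mfderiv_comp y (mdifferentiableAt_extChartAt (mem_chartAt_source_prod.1 hy).2)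
      mdifferentiableAt_snd
  have h2 : mfderiv (𝓘(ℝ, E₁).prod 𝓘(ℝ, E₂)) 𝓘(ℝ, E₂)
      (ContinuousLinearMap.snd ℝ E₁ E₂ ∘ extChartAt (𝓘(ℝ, E₁).prod 𝓘(ℝ, E₂)) x) y = _ :=
    mfderiv_comp y (ContinuousLinearMap.snd ℝ E₁ E₂).mdifferentiableAt
      (mdifferentiableAt_extChartAt hy)
  rw [ContinuousLinearMap.mfderiv_eq] at h2
  rw [mfderiv_snd_eq_fiberProj] at h1
  have h3 := congrArg (fun L : E₁ × E₂ →L[ℝ] E₂ => L (coordField u y)) (h1.symm.trans h2)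
  refine h3.trans ?_
  exact congrArg (fun w : E₁ × E₂ => w.2) (mfderiv_extChartAt_coordField hy u)

end Product

/-- The base points vary along a map `β` so that `gB` and `gF` can be evaluated along the
projections from the product. -/
theorem mdifferentiableAt_inner {E : Type*} [NormedAddCommGroup E] [NormedSpace ℝ E]
    {H : Type*} [TopologicalSpace H] {I : ModelWithCorners ℝ E H}
    {M : Type*} [TopologicalSpace M] [ChartedSpace H M] [IsManifold I ∞ M]
    {E' : Type*} [NormedAddCommGroup E'] [NormedSpace ℝ E']
    {H' : Type*} [TopologicalSpace H'] {I' : ModelWithCorners ℝ E' H'}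
    {N : Type*} [TopologicalSpace N] [ChartedSpace H' N]
    (g : ContMDiffRiemannianMetric I ∞ E (fun p : M => TangentSpace I p))
    {β : N → M} {v w : ∀ n, TangentSpace I (β n)} {x : N}
    (hv : MDifferentiableAt I' I.tangent (fun n => (⟨β n, v n⟩ : TangentBundle I M)) x)
    (hw : MDifferentiableAt I' I.tangent (fun n => (⟨β n, w n⟩ : TangentBundle I M)) x) :
    MDifferentiableAt I' 𝓘(ℝ, ℝ)
      (fun n => g.toRiemannianMetric.inner (β n) (v n) (w n)) x := by
  let : RiemannianBundle (fun p : M => TangentSpace I p) := ⟨g.toRiemannianMetric⟩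
  have hinf : IsContMDiffRiemannianBundle I ∞ E (fun p : M => TangentSpace I p) := inferInstance
  have : IsContMDiffRiemannianBundle I 1 E (fun p : M => TangentSpace I p) :=
    IsContMDiffRiemannianBundle.of_le (n := ∞) (by simp)
  exact MDifferentiableAt.inner_bundle (E := fun p : M => TangentSpace I p) hv hw

/-! ### The warped metric on coordinate fields -/

section Warped

variable {E₁ : Type*} [NormedAddCommGroup E₁] [NormedSpace ℝ E₁]
  {E₂ : Type*} [NormedAddCommGroup E₂] [NormedSpace ℝ E₂]
  {B : Type*} [TopologicalSpace B] [ChartedSpace E₁ B] [IsManifold 𝓘(ℝ, E₁) ∞ B]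
  {F : Type*} [TopologicalSpace F] [ChartedSpace E₂ F] [IsManifold 𝓘(ℝ, E₂) ∞ F]
  {gB : ContMDiffRiemannianMetric 𝓘(ℝ, E₁) ∞ E₁ (fun p : B => TangentSpace 𝓘(ℝ, E₁) p)}
  {gF : ContMDiffRiemannianMetric 𝓘(ℝ, E₂) ∞ E₂ (fun q : F => TangentSpace 𝓘(ℝ, E₂) q)}
  {f : B → ℝ} {hfpos : ∀ p, 0 < f p}

local notation "𝓙" => ModelWithCorners.prod 𝓘(ℝ, E₁) 𝓘(ℝ, E₂)

local notation "𝔤" =>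
  warpedMetric (ContMDiffRiemannianMetric.toRiemannianMetric gB)
    (ContMDiffRiemannianMetric.toRiemannianMetric gF) f hfpos

theorem isDifferentiableMetric_warpedMetric (hf : ContMDiff 𝓘(ℝ, E₁) 𝓘(ℝ, ℝ) ∞ f) :
    IsDifferentiableMetric (I := 𝓙) (M := B × F) 𝔤 := by
  intro Y Z x hY hZ
  have hfst : ∀ Y : ∀ x : B × F, TangentSpace 𝓙 x,
      MDifferentiableAt 𝓙 (𝓙).tangent (fun y => (⟨y, Y y⟩ : TangentBundle 𝓙 (B × F))) x →
      MDifferentiableAt 𝓙 𝓘(ℝ, E₁).tangent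
        (fun y => (⟨y.1, baseProj y (Y y)⟩ : TangentBundle 𝓘(ℝ, E₁) B)) x := by
    intro Y hY
    have h := (contMDiff_fst (I := 𝓘(ℝ, E₁)) (J := 𝓘(ℝ, E₂)) (M := B) (N := F)
      (n := ∞)).contMDiff_tangentMap (m := ∞) (by simp)
    have h2 := ((h.mdifferentiable (by simp)) ⟨x, Y x⟩).comp x hY
    refine h2.congr_of_eventuallyEq (Eventually.of_forall fun y => ?_)
    simp [tangentMap_prodFst, baseProj]
    rfl
  have hsnd : ∀ Y : ∀ x : B × F, TangentSpace 𝓙 x,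
      MDifferentiableAt 𝓙 (𝓙).tangent (fun y => (⟨y, Y y⟩ : TangentBundle 𝓙 (B × F))) x →
      MDifferentiableAt 𝓙 𝓘(ℝ, E₂).tangent
        (fun y => (⟨y.2, fiberProj y (Y y)⟩ : TangentBundle 𝓘(ℝ, E₂) F)) x := by
    intro Y hY
    have h := (contMDiff_snd (I := 𝓘(ℝ, E₁)) (J := 𝓘(ℝ, E₂)) (M := B) (N := F)
      (n := ∞)).contMDiff_tangentMap (m := ∞) (by simp)
    have h2 := ((h.mdifferentiable (by simp)) ⟨x, Y x⟩).comp x hY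
    refine h2.congr_of_eventuallyEq (Eventually.of_forall fun y => ?_)
    simp [tangentMap_prodSnd, fiberProj]
    rfl
  have hf' : MDifferentiableAt 𝓙 𝓘(ℝ, ℝ) (fun z : B × F => f z.1) x :=
    MDifferentiableAt.comp (g := f) x (hf.mdifferentiable (by simp) x.1) mdifferentiableAt_fst
  simp only [warpedMetric_inner, pow_two]
  exact (mdifferentiableAt_inner gB (hfst Y hY) (hfst Z hZ)).add
    ((hf'.mul hf').mul (mdifferentiableAt_inner gF (hsnd Y hY) (hsnd Z hZ)))

theorem inner_coordField {x y : B × F} (hy : y ∈ (chartAt (ModelProd E₁ E₂) x).source)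
    (u v : TangentSpace 𝓙 x) :
    (𝔤).inner y (coordField u y) (coordField v y) =
      gB.toRiemannianMetric.inner y.1 (coordField (baseProj x u) y.1)
        (coordField (baseProj x v) y.1)
      + f y.1 ^ 2 * gF.toRiemannianMetric.inner y.2 (coordField (fiberProj x u) y.2)
        (coordField (fiberProj x v) y.2) := by
  rw [warpedMetric_inner, baseProj_coordField hy, baseProj_coordField hy,
    fiberProj_coordField hy, fiberProj_coordField hy]

theorem inner_coordField_of_horizontal {x y : B × F}
    (hy : y ∈ (chartAt (ModelProd E₁ E₂) x).source) {a : TangentSpace 𝓙 x}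
    (ha : fiberProj x a = 0) (u : TangentSpace 𝓙 x) :
    (𝔤).inner y (coordField a y) (coordField u y) =
      gB.toRiemannianMetric.inner y.1 (coordField (baseProj x a) y.1)
        (coordField (baseProj x u) y.1) := by
  rw [inner_coordField hy, ha, coordField_zero (mem_chartAt_source_prod.1 hy).2]
  simp

theorem inner_coordField_of_vertical {x y : B × F}
    (hy : y ∈ (chartAt (ModelProd E₁ E₂) x).source) {v : TangentSpace 𝓙 x}
    (hv : baseProj x v = 0) (u : TangentSpace 𝓙 x) :
    (𝔤).inner y (coordField v y) (coordField u y) =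
      f y.1 ^ 2 * gF.toRiemannianMetric.inner y.2 (coordField (fiberProj x v) y.2)
        (coordField (fiberProj x u) y.2) := by
  rw [inner_coordField hy, hv, coordField_zero (mem_chartAt_source_prod.1 hy).1]
  simp

theorem inner_coordField_of_horizontal_of_vertical {x y : B × F}
    (hy : y ∈ (chartAt (ModelProd E₁ E₂) x).source) {a v : TangentSpace 𝓙 x}
    (ha : fiberProj x a = 0) (hv : baseProj x v = 0) :
    (𝔤).inner y (coordField a y) (coordField v y) = 0 := by
  rw [inner_coordField_of_horizontal hy ha, hv, coordField_zero (mem_chartAt_source_prod.1 hy).1]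
  simp

theorem mvfderiv_inner_of_horizontal_of_vertical {x y : B × F}
    (hy : y ∈ (chartAt (ModelProd E₁ E₂) x).source) {a v : TangentSpace 𝓙 x}
    (ha : fiberProj x a = 0) (hv : baseProj x v = 0) (t : TangentSpace 𝓙 y) :
    mvfderiv 𝓙 (fun z => (𝔤).inner z (coordField a z) (coordField v z)) y t = 0 := by
  have : (fun z => (𝔤).inner z (coordField a z) (coordField v z)) =ᶠ[𝓝 y] fun _ => 0 := by
    filter_upwards [(chartAt (ModelProd E₁ E₂) x).open_source.mem_nhds hy] with z hz
    exact inner_coordField_of_horizontal_of_vertical hz ha hv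
  rw [this.mvfderiv_apply_eq, mvfderiv_const]
  rfl

theorem mvfderiv_inner_of_vertical_of_horizontal {x y : B × F}
    (hy : y ∈ (chartAt (ModelProd E₁ E₂) x).source) {a v : TangentSpace 𝓙 x}
    (ha : fiberProj x a = 0) (hv : baseProj x v = 0) (t : TangentSpace 𝓙 y) :
    mvfderiv 𝓙 (fun z => (𝔤).inner z (coordField v z) (coordField a z)) y t = 0 := by
  simp only [(𝔤).symm _ (coordField v _) (coordField a _)]
  exact mvfderiv_inner_of_horizontal_of_vertical hy ha hv t

theorem fiberProj_coordField_eq_zero {x y : B × F}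
    (hy : y ∈ (chartAt (ModelProd E₁ E₂) x).source) {a : TangentSpace 𝓙 x}
    (ha : fiberProj x a = 0) : fiberProj y (coordField a y) = 0 := by
  rw [fiberProj_coordField hy, ha, coordField_zero (mem_chartAt_source_prod.1 hy).2]

omit [NormedSpace ℝ E₂] [IsManifold 𝓘(ℝ, E₂) ∞ F] in
theorem mdifferentiableAt_inner_base {x y : B × F}
    (hy : y ∈ (chartAt (ModelProd E₁ E₂) x).source) (u v : TangentSpace 𝓘(ℝ, E₁) x.1) :
    MDifferentiableAt 𝓘(ℝ, E₁) 𝓘(ℝ, ℝ)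
      (fun p => gB.toRiemannianMetric.inner p (coordField u p) (coordField v p)) y.1 :=
  mdifferentiableAt_inner gB (β := id)
    (mdifferentiableAt_coordField (mem_chartAt_source_prod.1 hy).1 u)
    (mdifferentiableAt_coordField (mem_chartAt_source_prod.1 hy).1 v)

omit [NormedSpace ℝ E₁] [IsManifold 𝓘(ℝ, E₁) ∞ B] in
theorem mdifferentiableAt_inner_fiber {x y : B × F}
    (hy : y ∈ (chartAt (ModelProd E₁ E₂) x).source) (u v : TangentSpace 𝓘(ℝ, E₂) x.2) :
    MDifferentiableAt 𝓘(ℝ, E₂) 𝓘(ℝ, ℝ)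
      (fun q => gF.toRiemannianMetric.inner q (coordField u q) (coordField v q)) y.2 :=
  mdifferentiableAt_inner gF (β := id)
    (mdifferentiableAt_coordField (mem_chartAt_source_prod.1 hy).2 u)
    (mdifferentiableAt_coordField (mem_chartAt_source_prod.1 hy).2 v)

theorem mvfderiv_inner_of_horizontal {x y : B × F}
    (hy : y ∈ (chartAt (ModelProd E₁ E₂) x).source) {a : TangentSpace 𝓙 x}
    (ha : fiberProj x a = 0) (b c : TangentSpace 𝓙 x) :
    mvfderiv 𝓙 (fun z => (𝔤).inner z (coordField a z) (coordField b z)) y (coordField c y) =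
      mvfderiv 𝓘(ℝ, E₁) (fun p => gB.toRiemannianMetric.inner p (coordField (baseProj x a) p)
        (coordField (baseProj x b) p)) y.1 (coordField (baseProj x c) y.1) := by
  have : (fun z => (𝔤).inner z (coordField a z) (coordField b z)) =ᶠ[𝓝 y] fun z =>
      gB.toRiemannianMetric.inner z.1 (coordField (baseProj x a) z.1)
        (coordField (baseProj x b) z.1) := by
    filter_upwards [(chartAt (ModelProd E₁ E₂) x).open_source.mem_nhds hy] with z hz
    exact inner_coordField_of_horizontal hz ha b
  rw [this.mvfderiv_apply_eq, ← baseProj_coordField hy]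
  exact mvfderiv_comp_fst (mdifferentiableAt_inner_base hy _ _) _

theorem mvfderiv_inner_of_vertical (hf : ContMDiff 𝓘(ℝ, E₁) 𝓘(ℝ, ℝ) ∞ f) {x y : B × F}
    (hy : y ∈ (chartAt (ModelProd E₁ E₂) x).source) {v : TangentSpace 𝓙 x}
    (hv : baseProj x v = 0) (w c : TangentSpace 𝓙 x) :
    mvfderiv 𝓙 (fun z => (𝔤).inner z (coordField v z) (coordField w z)) y (coordField c y) =
      2 * (mvfderiv 𝓘(ℝ, E₁) f y.1 (coordField (baseProj x c) y.1) / f y.1)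
        * (𝔤).inner y (coordField v y) (coordField w y)
      + f y.1 ^ 2 * mvfderiv 𝓘(ℝ, E₂)
        (fun q => gF.toRiemannianMetric.inner q (coordField (fiberProj x v) q)
        (coordField (fiberProj x w) q)) y.2 (coordField (fiberProj x c) y.2) := by
  have : (fun z => (𝔤).inner z (coordField v z) (coordField w z)) =ᶠ[𝓝 y] fun z => f z.1 ^ 2 *
      gF.toRiemannianMetric.inner z.2 (coordField (fiberProj x v) z.2)
        (coordField (fiberProj x w) z.2) := by
    filter_upwards [(chartAt (ModelProd E₁ E₂) x).open_source.mem_nhds hy] with z hz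
    exact inner_coordField_of_vertical hz hv w
  rw [this.mvfderiv_apply_eq, mvfderiv_fst_sq_mul_snd (hf.mdifferentiable (by simp) y.1)
    (mdifferentiableAt_inner_fiber hy _ _), baseProj_coordField hy, fiberProj_coordField hy,
    inner_coordField_of_vertical hy hv]
  have := (hfpos y.1).ne'
  field_simp

/-- Horizontal and vertical coordinate fields together span the tangent space at every point of the
chart domain, so positivity of the metric at `t` applies. -/
theorem eq_zero_of_inner_coordField_eq_zero {x y : B × F}
    (hy : y ∈ (chartAt (ModelProd E₁ E₂) x).source) {t : TangentSpace 𝓙 y}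
    (hH : ∀ a : TangentSpace 𝓙 x, fiberProj x a = 0 → (𝔤).inner y t (coordField a y) = 0)
    (hV : ∀ v : TangentSpace 𝓙 x, baseProj x v = 0 → (𝔤).inner y t (coordField v y) = 0) :
    t = 0 := by
  by_contra ht
  obtain ⟨w, rfl⟩ := exists_coordField_eq hy t
  obtain ⟨a, v, hw, ha, hv⟩ := exists_eq_horizontal_add_vertical w
  have := (𝔤).pos y _ ht
  nth_rewrite 2 [hw] at this
  rw [coordField_add hy, map_add, hH a ha, hV v hv] at this
  simp at this

end Warped

/-! ### Levi-Civita connection and mixed curvature of a warped product -/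

section WarpedConnection

variable {E₁ : Type*} [NormedAddCommGroup E₁] [NormedSpace ℝ E₁] [FiniteDimensional ℝ E₁]
  {E₂ : Type*} [NormedAddCommGroup E₂] [NormedSpace ℝ E₂] [FiniteDimensional ℝ E₂]
  {B : Type*} [TopologicalSpace B] [ChartedSpace E₁ B] [IsManifold 𝓘(ℝ, E₁) ∞ B]
  {F : Type*} [TopologicalSpace F] [ChartedSpace E₂ F] [IsManifold 𝓘(ℝ, E₂) ∞ F]
  {gB : ContMDiffRiemannianMetric 𝓘(ℝ, E₁) ∞ E₁ (fun p : B => TangentSpace 𝓘(ℝ, E₁) p)}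
  {gF : ContMDiffRiemannianMetric 𝓘(ℝ, E₂) ∞ E₂ (fun q : F => TangentSpace 𝓘(ℝ, E₂) q)}
  {f : B → ℝ} {hfpos : ∀ p, 0 < f p}

local notation "𝓙" => ModelWithCorners.prod 𝓘(ℝ, E₁) 𝓘(ℝ, E₂)

local notation "𝔤" =>
  warpedMetric (ContMDiffRiemannianMetric.toRiemannianMetric gB)
    (ContMDiffRiemannianMetric.toRiemannianMetric gF) f hfpos

variable {D : CovariantDerivative (𝓘(ℝ, E₁).prod 𝓘(ℝ, E₂)) (E₁ × E₂)
      (TangentSpace (𝓘(ℝ, E₁).prod 𝓘(ℝ, E₂)) : B × F → Type _)}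

/-- The logarithmic derivative `(d f / f)` of the warping function along the coordinate field
of the base vector `a`. -/
def logDerivField (f : B → ℝ) {p : B} (a : TangentSpace 𝓘(ℝ, E₁) p) (r : B) : ℝ :=
  mvfderiv 𝓘(ℝ, E₁) f r (coordField a r) / f r

omit [FiniteDimensional ℝ E₁] in
theorem mdifferentiableAt_logDerivField (hf : ContMDiff 𝓘(ℝ, E₁) 𝓘(ℝ, ℝ) ∞ f)
    (hf0 : ∀ p, f p ≠ 0) {p : B} (a : TangentSpace 𝓘(ℝ, E₁) p) {r : B}
    (hr : r ∈ (chartAt E₁ p).source) :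
    MDifferentiableAt 𝓘(ℝ, E₁) 𝓘(ℝ, ℝ) (logDerivField f a) r := by
  have h1 := (hf.contMDiff_tangentMap (m := ∞) (by simp)).mdifferentiable (by simp)
    ⟨r, coordField a r⟩
  have h2 := h1.comp r (mdifferentiableAt_coordField hr a)
  have h3 := ((contMDiff_snd_tangentBundle_modelSpace (𝕜 := ℝ) (n := ∞) ℝ
    𝓘(ℝ, ℝ)).mdifferentiable (by simp) _).comp r h2
  have h4 : MDifferentiableAt 𝓘(ℝ, E₁) 𝓘(ℝ, ℝ) (fun r => (f r)⁻¹) r :=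
    MDifferentiableAt.comp (g := fun t : ℝ => t⁻¹) r (differentiableAt_inv (hf0 r)).mdifferentiableAt
      (hf.mdifferentiable (by simp) r)
  exact MDifferentiableAt.mul h3 h4

/-- `∇_X V = (X f / f) V` for coordinate fields `X` from the base and `V` from the fiber. -/
theorem covariantDerivative_vertical_horizontal (hf : ContMDiff 𝓘(ℝ, E₁) 𝓘(ℝ, ℝ) ∞ f)
    (hD : IsLeviCivita 𝔤 D) {x y : B × F} (hy : y ∈ (chartAt (ModelProd E₁ E₂) x).source)
    {a v : TangentSpace 𝓙 x} (ha : fiberProj x a = 0) (hv : baseProj x v = 0) :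
    D (coordField v) y (coordField a y) = logDerivField f (baseProj x a) y.1 • coordField v y := by
  rw [← sub_eq_zero]
  refine eq_zero_of_inner_coordField_eq_zero (gB := gB) (gF := gF) (f := f) (hfpos := hfpos) hy
    (fun b hb => ?_) (fun w hw => ?_)
  -- Horizontal test field: two Koszul terms differentiate the zero function `g(X, V)`, and the
  -- third differentiates a function of the base along a vertical vector.
  · have h := two_mul_inner_covariantDerivative_coordField hD hy a v b
    rw [mvfderiv_inner_of_vertical_of_horizontal hy hb hv,
      mvfderiv_inner_of_horizontal_of_vertical hy ha hv, mvfderiv_inner_of_horizontal hy ha, hv,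
      coordField_zero (mem_chartAt_source_prod.1 hy).1, map_zero] at h
    simp only [map_sub, map_smul, sub_apply, smul_apply,
      (𝔤).symm y (coordField v y), inner_coordField_of_horizontal_of_vertical hy hb hv]
    simp only [smul_zero, sub_zero]
    linarith
  -- Vertical test field: only the derivative of `g(V, W)` along `a` survives, and `g(V, W)` is `f²`
  -- times a function on the fiber.
  · have h := two_mul_inner_covariantDerivative_coordField hD hy a v w
    rw [mvfderiv_inner_of_vertical hf hy hv, ha,
      mvfderiv_inner_of_horizontal_of_vertical hy ha hw,
      mvfderiv_inner_of_horizontal_of_vertical hy ha hv,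
      coordField_zero (mem_chartAt_source_prod.1 hy).2, map_zero] at h
    simp only [map_sub, map_smul, sub_apply, smul_apply,
      smul_eq_mul, logDerivField]
    linarith

theorem covariantDerivative_horizontal_vertical (hf : ContMDiff 𝓘(ℝ, E₁) 𝓘(ℝ, ℝ) ∞ f)
    (hD : IsLeviCivita 𝔤 D) {x y : B × F} (hy : y ∈ (chartAt (ModelProd E₁ E₂) x).source)
    {a v : TangentSpace 𝓙 x} (ha : fiberProj x a = 0) (hv : baseProj x v = 0) :
    D (coordField a) y (coordField v y) = logDerivField f (baseProj x a) y.1 • coordField v y := by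
  rw [covariantDerivative_coordField_comm hD.torsion_eq_zero hy,
    covariantDerivative_vertical_horizontal hf hD hy ha hv]

/-- This is the statement that the slices `B × {q}` are totally geodesic. -/
theorem inner_covariantDerivative_horizontal_vertical
    (hD : IsLeviCivita 𝔤 D) {x y : B × F} (hy : y ∈ (chartAt (ModelProd E₁ E₂) x).source)
    {a b v : TangentSpace 𝓙 x} (ha : fiberProj x a = 0) (hb : fiberProj x b = 0)
    (hv : baseProj x v = 0) :
    (𝔤).inner y (D (coordField b) y (coordField a y)) (coordField v y) = 0 := by
  have h := two_mul_inner_covariantDerivative_coordField hD hy a b v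
  rw [mvfderiv_inner_of_horizontal_of_vertical hy hb hv,
    mvfderiv_inner_of_horizontal_of_vertical hy ha hv, mvfderiv_inner_of_horizontal hy ha, hv,
    coordField_zero (mem_chartAt_source_prod.1 hy).1, map_zero] at h
  linarith

/-- Every Koszul term involves only `gB`. The explicit value is irrelevant later; what matters is
that vertical derivatives of this pairing vanish. -/
theorem exists_inner_covariantDerivative_horizontal
    (hD : IsLeviCivita 𝔤 D) {x : B × F} {a b c : TangentSpace 𝓙 x}
    (ha : fiberProj x a = 0) (hb : fiberProj x b = 0) :
    ∃ k : B → ℝ, ∀ y ∈ (chartAt (ModelProd E₁ E₂) x).source,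
      (𝔤).inner y (D (coordField b) y (coordField a y)) (coordField c y) = k y.1 := by
  refine ⟨fun p => (mvfderiv 𝓘(ℝ, E₁) (fun p => gB.toRiemannianMetric.inner p
        (coordField (baseProj x b) p) (coordField (baseProj x c) p)) p (coordField (baseProj x a) p)
      + mvfderiv 𝓘(ℝ, E₁) (fun p => gB.toRiemannianMetric.inner p
        (coordField (baseProj x a) p) (coordField (baseProj x c) p)) p (coordField (baseProj x b) p)
      - mvfderiv 𝓘(ℝ, E₁) (fun p => gB.toRiemannianMetric.inner p
        (coordField (baseProj x a) p) (coordField (baseProj x b) p)) p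
        (coordField (baseProj x c) p)) / 2, fun y hy => ?_⟩
  have h := two_mul_inner_covariantDerivative_coordField hD hy a b c
  rw [mvfderiv_inner_of_horizontal hy hb, mvfderiv_inner_of_horizontal hy ha,
    mvfderiv_inner_of_horizontal hy ha] at h
  dsimp only
  linarith

/-- Vertical derivatives do not touch `f`, so each Koszul term is `f²` times a function on the
fiber. This fixes the horizontal derivatives of the pairing. -/
theorem exists_inner_covariantDerivative_vertical (hf : ContMDiff 𝓘(ℝ, E₁) 𝓘(ℝ, ℝ) ∞ f)
    (hD : IsLeviCivita 𝔤 D) {x : B × F} {v w t : TangentSpace 𝓙 x}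
    (hv : baseProj x v = 0) (hw : baseProj x w = 0) (ht : baseProj x t = 0) :
    ∃ k : F → ℝ, ∀ y ∈ (chartAt (ModelProd E₁ E₂) x).source,
      (𝔤).inner y (D (coordField w) y (coordField v y)) (coordField t y)
        = f y.1 ^ 2 * k y.2 := by
  refine ⟨fun q => (mvfderiv 𝓘(ℝ, E₂) (fun q => gF.toRiemannianMetric.inner q
        (coordField (fiberProj x w) q) (coordField (fiberProj x t) q)) q
        (coordField (fiberProj x v) q)
      + mvfderiv 𝓘(ℝ, E₂) (fun q => gF.toRiemannianMetric.inner q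
        (coordField (fiberProj x v) q) (coordField (fiberProj x t) q)) q
        (coordField (fiberProj x w) q)
      - mvfderiv 𝓘(ℝ, E₂) (fun q => gF.toRiemannianMetric.inner q
        (coordField (fiberProj x v) q) (coordField (fiberProj x w) q)) q
        (coordField (fiberProj x t) q)) / 2, fun y hy => ?_⟩
  have h := two_mul_inner_covariantDerivative_coordField hD hy v w t
  rw [mvfderiv_inner_of_vertical hf hy hw, mvfderiv_inner_of_vertical hf hy hv,
    mvfderiv_inner_of_vertical hf hy hv, hv, hw, ht,
    coordField_zero (mem_chartAt_source_prod.1 hy).1, map_zero] at h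
  simp only [zero_div, mul_zero, zero_mul, zero_add] at h
  dsimp only
  linarith

-- Evaluates the second covariant derivatives in the mixed curvature: the first derivative is `λ V`
-- with `λ` a function of the base, so the Leibniz term drops out for vertical `u`.
omit [FiniteDimensional ℝ E₁] [FiniteDimensional ℝ E₂] in
theorem covariantDerivative_smul_vertical (hf : ContMDiff 𝓘(ℝ, E₁) 𝓘(ℝ, ℝ) ∞ f)
    (hf0 : ∀ p, f p ≠ 0) {x : B × F} {a v : TangentSpace 𝓙 x} {Y : ∀ y : B × F, TangentSpace 𝓙 y}
    (hY : ∀ y ∈ (chartAt (ModelProd E₁ E₂) x).source,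
      Y y = logDerivField f (baseProj x a) y.1 • coordField v y) (u : TangentSpace 𝓙 x) :
    D Y x u = logDerivField f (baseProj x a) x.1 • D (coordField v) x u
      + mvfderiv 𝓘(ℝ, E₁) (logDerivField f (baseProj x a)) x.1 (baseProj x u) • v := by
  have hx := mem_chart_source (ModelProd E₁ E₂) x
  have hl := mdifferentiableAt_logDerivField hf hf0 (baseProj x a)
    (mem_chartAt_source_prod.1 hx).1
  have hl' : MDifferentiableAt 𝓙 𝓘(ℝ, ℝ)
      (fun z : B × F => logDerivField f (baseProj x a) z.1) x :=
    MDifferentiableAt.comp (g := logDerivField f (baseProj x a)) x hl mdifferentiableAt_fst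
  have hc := mdifferentiableAt_coordField hx v
  have h1 : D Y x = D (fun y => logDerivField f (baseProj x a) y.1 • coordField v y) x := by
    refine (covariantDerivative_congr (mdifferentiableAt_field_smul hc hl') ?_).symm
    filter_upwards [(chartAt (ModelProd E₁ E₂) x).open_source.mem_nhds hx] with y hy
    exact (hY y hy).symm
  rw [h1, covariantDerivative_smul hc hl', mvfderiv_comp_fst hl, coordField_self]

variable [T2Space B] [T2Space F]

omit [T2Space B] [T2Space F] in
/-- For `a, b` horizontal and `v` vertical, `R(a, b) v` is vertical. -/
theorem baseProj_curvatureAt_vertical (hf : ContMDiff 𝓘(ℝ, E₁) 𝓘(ℝ, ℝ) ∞ f)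
    (hD : IsLeviCivita 𝔤 D) {x : B × F} {a b v : TangentSpace 𝓙 x}
    (ha : fiberProj x a = 0) (hb : fiberProj x b = 0) (hv : baseProj x v = 0) :
    baseProj x (curvatureAt D x a b v) = 0 := by
  have hx := mem_chart_source (ModelProd E₁ E₂) x
  have ea := covariantDerivative_vertical_horizontal hf hD hx ha hv
  have eb := covariantDerivative_vertical_horizontal hf hD hx hb hv
  simp only [coordField_self] at ea eb
  rw [curvatureAt_eq,
    covariantDerivative_smul_vertical hf (fun p => (hfpos p).ne')
      (fun y hy => covariantDerivative_vertical_horizontal hf hD hy hb hv),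
    covariantDerivative_smul_vertical hf (fun p => (hfpos p).ne')
      (fun y hy => covariantDerivative_vertical_horizontal hf hD hy ha hv), ea, eb]
  simp [hv]

omit [T2Space B] [T2Space F] in
/-- For `a` horizontal and `v, w` vertical, `R(v, w) a = 0`. -/
theorem curvatureAt_horizontal_eq_zero (hf : ContMDiff 𝓘(ℝ, E₁) 𝓘(ℝ, ℝ) ∞ f)
    (hD : IsLeviCivita 𝔤 D) {x : B × F} {a v w : TangentSpace 𝓙 x}
    (ha : fiberProj x a = 0) (hv : baseProj x v = 0) (hw : baseProj x w = 0) :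
    curvatureAt D x v w a = 0 := by
  have hx := mem_chart_source (ModelProd E₁ E₂) x
  have e := covariantDerivative_coordField_comm hD.torsion_eq_zero hx v w
  simp only [coordField_self] at e
  rw [curvatureAt_eq,
    covariantDerivative_smul_vertical hf (fun p => (hfpos p).ne')
      (fun y hy => covariantDerivative_horizontal_vertical hf hD hy ha hw),
    covariantDerivative_smul_vertical hf (fun p => (hfpos p).ne')
      (fun y hy => covariantDerivative_horizontal_vertical hf hD hy ha hv), hv, hw, e]
  simp

/-- For `a` horizontal and `v, w` vertical, `R(a, w) v` is horizontal. -/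
theorem fiberProj_curvatureAt_vertical (hf : ContMDiff 𝓘(ℝ, E₁) 𝓘(ℝ, ℝ) ∞ f)
    (hD : IsLeviCivita 𝔤 D) {x : B × F} {a v w : TangentSpace 𝓙 x}
    (ha : fiberProj x a = 0) (hv : baseProj x v = 0) (hw : baseProj x w = 0) :
    fiberProj x (curvatureAt D x a w v) = 0 := by
  have hx := mem_chart_source (ModelProd E₁ E₂) x
  have key : ∀ t : TangentSpace 𝓙 x, baseProj x t = 0 →
      (𝔤).inner x (curvatureAt D x a w v) t = 0 := by
    intro t ht
    -- With `λ = a f / f`, differentiating `g(∇_w v, t)` along `a` multiplies it by `2λ`. Since `∇_a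
    -- t = λ t`, one `λ` is absorbed by `t`, leaving `g(∇_a ∇_w v, t) = λ g(∇_w v, t)`. This cancels
    -- against `∇_w ∇_a v = λ ∇_w v`.
    obtain ⟨k, hk⟩ := exists_inner_covariantDerivative_vertical hf hD hw hv ht
    have hY := mdifferentiableAt_covariantDerivative_coordField hD.smooth hx v w
    have hT := mdifferentiableAt_coordField hx t
    have hm := hD.metric _ _ x hY hT a
    rw [mvfderiv_of_fst_sq_mul_snd (hf.mdifferentiable (by simp) x.1) (hfpos x.1).ne'
      (isDifferentiableMetric_warpedMetric hf _ _ x hY hT)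
      (by filter_upwards [(chartAt (ModelProd E₁ E₂) x).open_source.mem_nhds hx] with y hy
          exact hk y hy) ha] at hm
    have et := covariantDerivative_vertical_horizontal hf hD hx ha ht
    have el : logDerivField f (baseProj x a) x.1
      = mvfderiv 𝓘(ℝ, E₁) f x.1 (baseProj x a) / f x.1 := by
      rw [logDerivField, coordField_self]
    simp only [coordField_self] at et hm
    rw [et, ← el, map_smul, smul_eq_mul] at hm
    rw [curvatureAt_eq, covariantDerivative_smul_vertical hf (fun p => (hfpos p).ne')
      (fun y hy => covariantDerivative_vertical_horizontal hf hD hy ha hv), hw]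
    simp only [map_sub, map_smul, map_zero, zero_smul, add_zero,
      sub_apply, smul_apply, smul_eq_mul]
    linarith
  by_contra hne
  obtain ⟨c, t, hct, hc, ht⟩ := exists_eq_horizontal_add_vertical (curvatureAt D x a w v)
  have h := key t ht
  rw [warpedMetric_inner, ht, map_zero, zero_add] at h
  have e : fiberProj x (curvatureAt D x a w v) = fiberProj x t := by
    rw [hct, map_add, hc, zero_add]
  rw [e] at h hne
  have h1 := gF.toRiemannianMetric.pos x.2 _ hne
  have h2 := pow_pos (hfpos x.1) 2
  have := mul_pos h2 h1
  linarith

/-- For `a, b` horizontal and `v` vertical, `R(v, b) a` is vertical. -/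
theorem baseProj_curvatureAt_horizontal (hf : ContMDiff 𝓘(ℝ, E₁) 𝓘(ℝ, ℝ) ∞ f)
    (hD : IsLeviCivita 𝔤 D) {x : B × F} {a b v : TangentSpace 𝓙 x}
    (ha : fiberProj x a = 0) (hb : fiberProj x b = 0) (hv : baseProj x v = 0) :
    baseProj x (curvatureAt D x v b a) = 0 := by
  have hx := mem_chart_source (ModelProd E₁ E₂) x
  have key : ∀ c : TangentSpace 𝓙 x, fiberProj x c = 0 →
      (𝔤).inner x (curvatureAt D x v b a) c = 0 := by
    intro c hc
    -- The derivative of `g(∇_b a, c)` along `v` is zero, and `∇_v c` is a multiple of `v`, hence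
    -- orthogonal to `∇_b a`; so `g(∇_v ∇_b a, c) = 0`. The other half, `∇_b ∇_v a`, is a multiple
    -- of `v`.
    obtain ⟨k, hk⟩ := exists_inner_covariantDerivative_horizontal (c := c) hD hb ha
    have hY := mdifferentiableAt_covariantDerivative_coordField hD.smooth hx a b
    have hC := mdifferentiableAt_coordField hx c
    have hm := hD.metric _ _ x hY hC v
    rw [mvfderiv_eq_zero_of_base
      (by filter_upwards [(chartAt (ModelProd E₁ E₂) x).open_source.mem_nhds hx] with y hy
          exact hk y hy) hv] at hm
    have ec := covariantDerivative_horizontal_vertical hf hD hx hc hv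
    have eb := covariantDerivative_vertical_horizontal hf hD hx hb hv
    have h0 := inner_covariantDerivative_horizontal_vertical hD hx hb ha hv
    have hvc := inner_coordField_of_horizontal_of_vertical (gB := gB) (gF := gF) (f := f)
      (hfpos := hfpos) hx hc hv
    simp only [coordField_self] at ec eb hm h0 hvc
    rw [ec, map_smul, h0] at hm
    rw [curvatureAt_eq, covariantDerivative_smul_vertical hf (fun p => (hfpos p).ne')
      (fun y hy => covariantDerivative_horizontal_vertical hf hD hy ha hv), eb]
    simp only [map_sub, map_add, map_smul,
      sub_apply, add_apply,
      smul_apply, (𝔤).symm x v c, hvc, smul_zero, add_zero, sub_zero]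
    rw [smul_zero, add_zero] at hm
    exact hm.symm
  by_contra hne
  obtain ⟨c, t, hct, hc, ht⟩ := exists_eq_horizontal_add_vertical (curvatureAt D x v b a)
  have h := key c hc
  rw [warpedMetric_inner, hc, map_zero, mul_zero, add_zero] at h
  have e : baseProj x (curvatureAt D x v b a) = baseProj x c := by
    rw [hct, map_add, ht, add_zero]
  rw [e] at h hne
  exact (gB.toRiemannianMetric.pos x.1 _ hne).ne' h

end WarpedConnection

/-! ### Two general tools: block traces, and functions with zero derivative -/

theorem trace_eq_zero_of_offDiagonal {E₁ E₂ : Type*} [AddCommGroup E₁] [Module ℝ E₁]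
    [FiniteDimensional ℝ E₁] [AddCommGroup E₂] [Module ℝ E₂] [FiniteDimensional ℝ E₂]
    (A : E₁ × E₂ →ₗ[ℝ] E₁ × E₂) (h₁ : ∀ a, (A (a, 0)).1 = 0) (h₂ : ∀ v, (A (0, v)).2 = 0) :
    LinearMap.trace ℝ (E₁ × E₂) A = 0 := by
  have e : A = (A ∘ₗ LinearMap.inl ℝ E₁ E₂) ∘ₗ LinearMap.fst ℝ E₁ E₂
      + (A ∘ₗ LinearMap.inr ℝ E₁ E₂) ∘ₗ LinearMap.snd ℝ E₁ E₂ := by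
    refine LinearMap.ext fun w => ?_
    simp [← map_add]
  have e₁ : LinearMap.fst ℝ E₁ E₂ ∘ₗ (A ∘ₗ LinearMap.inl ℝ E₁ E₂) = 0 :=
    LinearMap.ext fun a => h₁ a
  have e₂ : LinearMap.snd ℝ E₁ E₂ ∘ₗ (A ∘ₗ LinearMap.inr ℝ E₁ E₂) = 0 :=
    LinearMap.ext fun v => h₂ v
  -- Cyclicity of the trace turns each summand into the trace of a diagonal block.
  rw [e, map_add, LinearMap.trace_comp_comm', e₁,
    LinearMap.trace_comp_comm' (LinearMap.snd ℝ E₁ E₂), e₂, map_zero, map_zero, add_zero]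

/-- In a chart the derivative vanishes on a ball, which is convex, so the function is locally
constant; preconnectedness makes it constant. -/
theorem exists_eq_const_of_mvfderiv_eq_zero {E : Type*} [NormedAddCommGroup E] [NormedSpace ℝ E]
    {B : Type*} [TopologicalSpace B] [PreconnectedSpace B] [ChartedSpace E B]
    [IsManifold 𝓘(ℝ, E) ∞ B] {h : B → ℝ} (hd : MDifferentiable 𝓘(ℝ, E) 𝓘(ℝ, ℝ) h)
    (h0 : ∀ p, mvfderiv 𝓘(ℝ, E) h p = 0) (p q : B) : h p = h q := by
  refine IsLocallyConstant.apply_eq_of_preconnectedSpace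
    ((IsLocallyConstant.iff_eventually_eq h).2 fun p => ?_) p q
  let φ := extChartAt 𝓘(ℝ, E) p
  obtain ⟨r, hr, hball⟩ := Metric.isOpen_iff.1 (isOpen_extChartAt_target (I := 𝓘(ℝ, E)) p) (φ p)
    (mem_extChartAt_target p)
  have hderiv : ∀ z ∈ Metric.ball (φ p) r, HasFDerivAt (h ∘ φ.symm) (0 : E →L[ℝ] ℝ) z := by
    intro z hz
    have hs : MDifferentiableAt 𝓘(ℝ, E) 𝓘(ℝ, E) φ.symm z :=
      ((contMDiffOn_extChartAt_symm (I := 𝓘(ℝ, E)) (n := ∞) p).contMDiffAt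
        ((isOpen_extChartAt_target p).mem_nhds (hball hz))).mdifferentiableAt (by simp)
    have hc := (hd (φ.symm z)).hasMFDerivAt.comp z hs.hasMFDerivAt
    have e0 : mfderiv 𝓘(ℝ, E) 𝓘(ℝ, ℝ) h (φ.symm z) = 0 := h0 (φ.symm z)
    rw [e0, ContinuousLinearMap.zero_comp] at hc
    exact hasMFDerivAt_iff_hasFDerivAt.1 hc
  have hconst : ∀ z ∈ Metric.ball (φ p) r, (h ∘ φ.symm) z = (h ∘ φ.symm) (φ p) := by
    intro z hz
    exact (convex_ball (φ p) r).is_const_of_fderivWithin_eq_zero (𝕜 := ℝ)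
      (fun z hz => (hderiv z hz).differentiableAt.differentiableWithinAt)
      (fun z hz => by
        rw [fderivWithin_of_isOpen Metric.isOpen_ball hz]
        exact (hderiv z hz).fderiv) hz (Metric.mem_ball_self hr)
  filter_upwards [extChartAt_source_mem_nhds (I := 𝓘(ℝ, E)) p,
    (continuousAt_extChartAt (I := 𝓘(ℝ, E)) p).preimage_mem_nhds (Metric.ball_mem_nhds _ hr)]
    with z hz hz'
  have := hconst (φ z) hz'
  simp only [Function.comp_apply] at this
  rwa [φ.left_inv hz, φ.left_inv (mem_extChartAt_source p)] at this

/-! ### Mixed Ricci terms and their consequences for `P` and `f` -/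

section Mixed

variable {E₁ : Type*} [NormedAddCommGroup E₁] [NormedSpace ℝ E₁] [FiniteDimensional ℝ E₁]
  {E₂ : Type*} [NormedAddCommGroup E₂] [NormedSpace ℝ E₂] [FiniteDimensional ℝ E₂]
  {B : Type*} [TopologicalSpace B] [ChartedSpace E₁ B] [IsManifold 𝓘(ℝ, E₁) ∞ B]
  {F : Type*} [TopologicalSpace F] [ChartedSpace E₂ F] [IsManifold 𝓘(ℝ, E₂) ∞ F]
  {gB : ContMDiffRiemannianMetric 𝓘(ℝ, E₁) ∞ E₁ (fun p : B => TangentSpace 𝓘(ℝ, E₁) p)}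
  {gF : ContMDiffRiemannianMetric 𝓘(ℝ, E₂) ∞ E₂ (fun q : F => TangentSpace 𝓘(ℝ, E₂) q)}
  {f : B → ℝ} {hfpos : ∀ p, 0 < f p}

local notation "𝓙" => ModelWithCorners.prod 𝓘(ℝ, E₁) 𝓘(ℝ, E₂)

local notation "𝔤" =>
  warpedMetric (ContMDiffRiemannianMetric.toRiemannianMetric gB)
    (ContMDiffRiemannianMetric.toRiemannianMetric gF) f hfpos

variable {D : CovariantDerivative (𝓘(ℝ, E₁).prod 𝓘(ℝ, E₂)) (E₁ × E₂)
      (TangentSpace (𝓘(ℝ, E₁).prod 𝓘(ℝ, E₂)) : B × F → Type _)}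

omit [FiniteDimensional ℝ E₁] [FiniteDimensional ℝ E₂] in
theorem inner_eq_zero_of_horizontal_of_vertical {x : B × F} {a v : TangentSpace 𝓙 x}
    (ha : fiberProj x a = 0) (hv : baseProj x v = 0) : (𝔤).inner x a v = 0 := by
  rw [warpedMetric_inner, ha, hv]
  simp

variable [T2Space B] [T2Space F]

/-- The endomorphism `R(a, ·) v` exchanges horizontal and vertical vectors, so it is off-diagonal.
-/
theorem trace_curvatureEnd_horizontal_vertical (hf : ContMDiff 𝓘(ℝ, E₁) 𝓘(ℝ, ℝ) ∞ f)
    (hD : IsLeviCivita 𝔤 D) {x : B × F} {a v : TangentSpace 𝓙 x}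
    (ha : fiberProj x a = 0) (hv : baseProj x v = 0) :
    LinearMap.trace ℝ (TangentSpace 𝓙 x) (curvatureEnd hD.smooth a v) = 0 :=
  trace_eq_zero_of_offDiagonal (E₁ := E₁) (E₂ := E₂) (curvatureEnd hD.smooth a v)
    (fun _ => baseProj_curvatureAt_vertical hf hD ha rfl hv)
    (fun _ => fiberProj_curvatureAt_vertical hf hD ha hv rfl)

/-- The other order is handled directly instead of through symmetry of the Ricci tensor: `R(v, ·) a`
sends horizontal vectors to vertical ones and kills vertical ones. -/
theorem trace_curvatureEnd_vertical_horizontal (hf : ContMDiff 𝓘(ℝ, E₁) 𝓘(ℝ, ℝ) ∞ f)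
    (hD : IsLeviCivita 𝔤 D) {x : B × F} {a v : TangentSpace 𝓙 x}
    (ha : fiberProj x a = 0) (hv : baseProj x v = 0) :
    LinearMap.trace ℝ (TangentSpace 𝓙 x) (curvatureEnd hD.smooth v a) = 0 := by
  refine trace_eq_zero_of_offDiagonal (E₁ := E₁) (E₂ := E₂) (curvatureEnd hD.smooth v a)
    (fun _ => baseProj_curvatureAt_horizontal hf hD ha rfl hv) (fun w => ?_)
  have h := curvatureAt_horizontal_eq_zero hf hD (w := ((0 : E₁), w)) ha hv rfl
  exact (congrArg (fiberProj x) h).trans (map_zero _)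

theorem inner_covariantDerivative_eq_zero_of_mixed_ricci_eq_zero
    (hf : ContMDiff 𝓘(ℝ, E₁) 𝓘(ℝ, ℝ) ∞ f) (hD : IsLeviCivita 𝔤 D)
    (hdim : 2 ≤ finrank ℝ (E₁ × E₂))
    {P : ∀ x : B × F, TangentSpace 𝓙 x} (hP : IsSmoothField 𝓙 P) (hPF : IsTangentToFiber P)
    {x : B × F} {a v : TangentSpace 𝓙 x} (ha : fiberProj x a = 0) (hv : baseProj x v = 0) :
    (ricci 𝔤 (semiSymmetric 𝔤 D P) x a v = 0 → (𝔤).inner x (D P x a) v = 0) ∧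
    (ricci 𝔤 (semiSymmetric 𝔤 D P) x v a = 0 → (𝔤).inner x (D P x v) a = 0) := by
  have hn : (finrank ℝ (E₁ × E₂) : ℝ) - 1 ≠ 0 := by
    have : (2 : ℝ) ≤ finrank ℝ (E₁ × E₂) := by exact_mod_cast hdim
    linarith
  have hPa : (𝔤).inner x (P x) a = 0 := by
    rw [(𝔤).symm]
    exact inner_eq_zero_of_horizontal_of_vertical ha (hPF x)
  constructor <;> intro h
  · rw [ricci_semiSymmetric (isDifferentiableMetric_warpedMetric hf) hD hP,
      trace_curvatureEnd_horizontal_vertical hf hD ha hv, hPa, zero_mul, sub_zero, zero_add] at h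
    exact (mul_eq_zero.1 h).resolve_left hn
  · rw [ricci_semiSymmetric (isDifferentiableMetric_warpedMetric hf) hD hP,
      trace_curvatureEnd_vertical_horizontal hf hD ha hv, hPa, mul_zero, sub_zero, zero_add] at h
    exact (mul_eq_zero.1 h).resolve_left hn

omit [T2Space B] [T2Space F] in
/-- If `∇_P P` has no horizontal part at a point where the vertical field `P` does not vanish,
then the warping function is critical there. -/
theorem mvfderiv_eq_zero_of_inner_covariantDerivative_eq_zero
    (hf : ContMDiff 𝓘(ℝ, E₁) 𝓘(ℝ, ℝ) ∞ f) (hD : IsLeviCivita 𝔤 D)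
    {P : ∀ x : B × F, TangentSpace 𝓙 x} (hP : IsSmoothField 𝓙 P) (hPF : IsTangentToFiber P)
    {x : B × F} (hPx : P x ≠ 0)
    (h : ∀ a : TangentSpace 𝓙 x, fiberProj x a = 0 → (𝔤).inner x (D P x (P x)) a = 0) :
    mvfderiv 𝓘(ℝ, E₁) f x.1 = 0 := by
  have hx := mem_chart_source (ModelProd E₁ E₂) x
  refine ContinuousLinearMap.ext fun a₁ => ?_
  let a : TangentSpace 𝓙 x := ((show E₁ from a₁), (0 : E₂))
  have ha : fiberProj x a = 0 := rfl
  have hm := hD.metric _ P x (mdifferentiableAt_coordField hx a)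
    ((hP x).mdifferentiableAt (by simp)) (P x)
  -- Differentiate `g(a, P) = 0` along `P`: the term `g(a, ∇_P P)` vanishes by hypothesis, and `∇_P
  -- a = (a f / f) P`.
  have hz : (fun y => (𝔤).inner y (coordField a y) (P y)) =ᶠ[𝓝 x] fun _ => 0 := by
    filter_upwards [(chartAt (ModelProd E₁ E₂) x).open_source.mem_nhds hx] with y hy
    exact inner_eq_zero_of_horizontal_of_vertical (fiberProj_coordField_eq_zero hy ha) (hPF y)
  have e := covariantDerivative_horizontal_vertical hf hD hx ha (hPF x)
  simp only [coordField_self] at e hm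
  rw [hz.mvfderiv_apply_eq, mvfderiv_const, e, (𝔤).symm x a, h a ha, add_zero, map_smul] at hm
  have hm' : 0 = logDerivField f (baseProj x a) x.1 * (𝔤).inner x (P x) (P x) := hm
  have hl := (mul_eq_zero.1 hm'.symm).resolve_right ((𝔤).pos x _ hPx).ne'
  rw [logDerivField, coordField_self] at hl
  exact (div_eq_zero_iff.1 hl).resolve_right (hfpos x.1).ne'

-- The derivative of `|P|²` along a horizontal `a` is `2 g(∇_a P, P)`, and the inclusion of the
-- slice `B × {q}` has horizontal differential.
omit [T2Space B] [T2Space F] in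
theorem inner_self_const_along_base [PreconnectedSpace B]
    (hf : ContMDiff 𝓘(ℝ, E₁) 𝓘(ℝ, ℝ) ∞ f) (hD : IsLeviCivita 𝔤 D)
    {P : ∀ x : B × F, TangentSpace 𝓙 x} (hP : IsSmoothField 𝓙 P) {q : F}
    (h : ∀ p : B, ∀ a : TangentSpace 𝓙 (p, q), fiberProj (p, q) a = 0 →
      (𝔤).inner (p, q) (D P (p, q) a) (P (p, q)) = 0) (p p' : B) :
    (𝔤).inner (p, q) (P (p, q)) (P (p, q)) = (𝔤).inner (p', q) (P (p', q)) (P (p', q)) := by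
  have hι : ∀ p : B, MDifferentiableAt 𝓘(ℝ, E₁) 𝓙 (fun p : B => (p, q)) p :=
    fun p => mdifferentiableAt_id.prodMk mdifferentiableAt_const
  have hPd : ∀ x, MDifferentiableAt 𝓙 (𝓙).tangent
      (fun y => (⟨y, P y⟩ : TangentBundle 𝓙 (B × F))) x :=
    fun x => (hP x).mdifferentiableAt (by simp)
  have hN := fun p : B =>
    isDifferentiableMetric_warpedMetric (gB := gB) (gF := gF) (hfpos := hfpos) hf P P (p, q)
      (hPd _) (hPd _)
  refine exists_eq_const_of_mvfderiv_eq_zero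
    (h := fun p : B => (𝔤).inner (p, q) (P (p, q)) (P (p, q)))
    (fun p => MDifferentiableAt.comp (g := fun y : B × F => (𝔤).inner y (P y) (P y)) p
      (hN p) (hι p)) (fun p => ?_) p p'
  refine ContinuousLinearMap.ext fun a₁ => ?_
  have e := mvfderiv_comp_apply (g := fun y : B × F => (𝔤).inner y (P y) (P y)) p
    (hN p) (hι p) a₁
  have ha : fiberProj (p, q) (mfderiv 𝓘(ℝ, E₁) 𝓙 (fun p : B => (p, q)) p a₁) = 0 := by
    rw [mfderiv_prod_left]
    rfl
  refine e.trans ?_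
  rw [hD.metric P P (p, q) (hPd _) (hPd _), (𝔤).symm _ (P (p, q)), h p _ ha, add_zero]
  rfl

end Mixed

end WarpedProduct

end

/-! ### The main theorem -/

open WarpedProduct in
theorem theorem4p16
    {E₁ : Type*} [NormedAddCommGroup E₁] [NormedSpace ℝ E₁] [FiniteDimensional ℝ E₁]
    {E₂ : Type*} [NormedAddCommGroup E₂] [NormedSpace ℝ E₂] [FiniteDimensional ℝ E₂]
    {B : Type*} [TopologicalSpace B] [T2Space B] [SecondCountableTopology B] [PreconnectedSpace B]
    [ChartedSpace E₁ B] [IsManifold 𝓘(ℝ, E₁) ∞ B]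
    {F : Type*} [TopologicalSpace F] [T2Space F] [SecondCountableTopology F]
    [ChartedSpace E₂ F] [IsManifold 𝓘(ℝ, E₂) ∞ F]
    (hdimB : 2 ≤ finrank ℝ E₁) (hdimF : 2 ≤ finrank ℝ E₂)
    (gB : ContMDiffRiemannianMetric 𝓘(ℝ, E₁) ∞ E₁ (fun p : B => TangentSpace 𝓘(ℝ, E₁) p))
    (gF : ContMDiffRiemannianMetric 𝓘(ℝ, E₂) ∞ E₂ (fun q : F => TangentSpace 𝓘(ℝ, E₂) q))
    (f : B → ℝ) (hf : ContMDiff 𝓘(ℝ, E₁) 𝓘(ℝ, ℝ) ∞ f) (hfpos : ∀ p, 0 < f p)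
    (nabla : CovariantDerivative (𝓘(ℝ, E₁).prod 𝓘(ℝ, E₂)) (E₁ × E₂)
      (TangentSpace (𝓘(ℝ, E₁).prod 𝓘(ℝ, E₂)) : B × F → Type _))
    (hnabla : IsLeviCivita
      (warpedMetric gB.toRiemannianMetric gF.toRiemannianMetric f hfpos) nabla)
    (nablaF : CovariantDerivative 𝓘(ℝ, E₂) E₂ (TangentSpace 𝓘(ℝ, E₂) : F → Type _))
    (hnablaF : IsLeviCivita gF.toRiemannianMetric nablaF)
    (P U₁ U₂ : ∀ x : B × F, TangentSpace (𝓘(ℝ, E₁).prod 𝓘(ℝ, E₂)) x)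
    (hP : IsSmoothField (𝓘(ℝ, E₁).prod 𝓘(ℝ, E₂)) P)
    (hPF : IsTangentToFiber P) (hU₁F : IsTangentToFiber U₁) (hU₂F : IsTangentToFiber U₂)
    (hnonmetric : ¬ IsMetric
      (warpedMetric gB.toRiemannianMetric gF.toRiemannianMetric f hfpos)
      (semiSymmetric (warpedMetric gB.toRiemannianMetric gF.toRiemannianMetric f hfpos) nabla P))
    (a b c : ℝ)
    (hM : IsGeneralizedQuasiEinstein
      (warpedMetric gB.toRiemannianMetric gF.toRiemannianMetric f hfpos)
      (semiSymmetric (warpedMetric gB.toRiemannianMetric gF.toRiemannianMetric f hfpos) nabla P)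
      a b c U₁ U₂)
    (hbc : b ≠ 0 ∨ c ≠ 0)
    (hparallel : ∀ (p : B) (q : F), nablaF (fun q' => fiberProj (p, q') (P (p, q'))) q = 0) :
    ∃ k : ℝ, ∀ p, f p = k := by
  have hsum : finrank ℝ (E₁ × E₂) = finrank ℝ E₁ + finrank ℝ E₂ := finrank_prod
  have hdim : 2 ≤ finrank ℝ (E₁ × E₂) := by omega
  -- If `P` vanished identically, the semi-symmetric connection would be the Levi-Civita connection,
  -- which is metric.
  obtain ⟨⟨p₀, q₀⟩, hP₀⟩ : ∃ x, P x ≠ 0 := by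
    by_contra! h0
    obtain rfl : P = fun _ => 0 := funext h0
    rw [semiSymmetric_zero] at hnonmetric
    exact hnonmetric hnabla.metric
  have hric : ∀ (x : B × F) (a v : TangentSpace (𝓘(ℝ, E₁).prod 𝓘(ℝ, E₂)) x),
      fiberProj x a = 0 → baseProj x v = 0 → _ := fun x a v ha hv =>
    inner_covariantDerivative_eq_zero_of_mixed_ricci_eq_zero (x := x) (a := a) (v := v)
      hf hnabla hdim hP hPF ha hv
  have hH : ∀ (x : B × F) (a v : TangentSpace (𝓘(ℝ, E₁).prod 𝓘(ℝ, E₂)) x),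
      fiberProj x a = 0 → baseProj x v = 0 →
      (warpedMetric gB.toRiemannianMetric gF.toRiemannianMetric f hfpos).inner x
        (nabla P x a) v = 0 := by
    intro x a v ha hv
    refine (hric x a v ha hv).1 ?_
    rw [hM.ricci_eq, inner_eq_zero_of_horizontal_of_vertical ha hv,
      inner_eq_zero_of_horizontal_of_vertical ha (hU₁F x),
      inner_eq_zero_of_horizontal_of_vertical ha (hU₂F x)]
    ring
  have hV : ∀ (x : B × F) (a v : TangentSpace (𝓘(ℝ, E₁).prod 𝓘(ℝ, E₂)) x),
      fiberProj x a = 0 → baseProj x v = 0 →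
      (warpedMetric gB.toRiemannianMetric gF.toRiemannianMetric f hfpos).inner x
        (nabla P x v) a = 0 := by
    intro x a v ha hv
    refine (hric x a v ha hv).2 ?_
    rw [hM.ricci_eq, RiemannianMetric.symm _ x v a,
      inner_eq_zero_of_horizontal_of_vertical ha hv,
      inner_eq_zero_of_horizontal_of_vertical ha (hU₁F x),
      inner_eq_zero_of_horizontal_of_vertical ha (hU₂F x)]
    ring
  -- One nonzero value spreads over the slice `B × {q₀}`, which meets every fiber; this makes `df`
  -- vanish on all of `B`.
  have hPne : ∀ p, P (p, q₀) ≠ 0 := by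
    intro p hp
    have h := inner_self_const_along_base hf hnabla hP (q := q₀)
      (fun p a ha => hH (p, q₀) a _ ha (hPF _)) p₀ p
    rw [hp, map_zero] at h
    exact (RiemannianMetric.pos _ _ _ hP₀).ne' h
  refine ⟨f p₀, fun p => exists_eq_const_of_mvfderiv_eq_zero (hf.mdifferentiable (by simp))
    (fun p => ?_) p p₀⟩
  exact mvfderiv_eq_zero_of_inner_covariantDerivative_eq_zero (x := (p, q₀)) hf hnabla hP hPF
    (hPne p) (fun a ha => hV (p, q₀) a _ ha (hPF _))
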